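/- Let $k,n\ge 0$ be integers. For a $k\times n$ matrix $A$ with columns $A_1,\dots,A_n$ and a $k$-element set $I=\{i_1<\dots<i_k\}\subseteq[n]$ put $\Delta_I(A)=\det(A_{i_1},\dots,A_{i_k})$. The column matroid of a $k\times n$ matrix of rank $k$ is the collection of those $k$-element sets $J\subseteq[n]$ for which the columns $A_j$, $j\in J$, form a basis. A positroid (of rank $k$ on $[n]$) is the column matroid of a real $k\times n$ matrix of rank $k$ all of whose maximal minors are non-negative. For a positroid $\mathcal M$, let $\mathrm{Mat}^\circ(\mathcal M)$ be the set of complex $k\times n$ matrices $A$ of rank $k$ such that $\mathcal M$ is the smallest positroid containing the column matroid of $A$. Let $$\widetilde\Pi^\circ(\mathcal M)=SL_k\backslash\mathrm{Mat}^\circ(\mathcal M)=\{(\Delta_I(A))_I : A\in \mathrm{Mat}^\circ(\mathcal M)\}\subseteq\mathbb C^{\binom{[n]}{k}},$$ $$\Pi^\circ(\mathcal M)=GL_k\backslash\mathrm{Mat}^\circ(\mathcal M)=\{\operatorname{rowspan}(A) : A\in \mathrm{Mat}^\circ(\mathcal M)\}\subseteq Gr(k,n),$$ with the variety structures induced from affine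 space and from the Plücker embedding of the Grassmannian $Gr(k,n)$ of $k$-planes in $\mathbb C^n$, respectively. For $a\in[n]$ let $\prec_a$ be the order $a\prec_a a+1\prec_a\dots\prec_a n\prec_a 1\prec_a\dots\prec_a a-1$ on $[n]$, and compare $k$-element sets $B=\{b_1\prec_a\dots\prec_a b_k\}$ and $C=\{c_1\prec_a\dots\prec_a c_k\}$ by $B\preceq_a C$ iff $b_i\preceq_a c_i$ for all $i$. For a complex $k\times n$ matrix $A$ of rank $k$, let $\vec I_a$ be the $\prec_a$-minimal, and $\overleftarrow I_a$ the $\prec_{a+1}$-maximal, element of the column matroid of $A$ (indices modulo $n$). The right twist $\vec\tau(A)$ and the left twist $\overleftarrow\tau(A)$ are the $k\times n$ matrices whose $a$th columns are the unique vectors with $$\langle\vec\tau(A)_a\mid A_b\rangle=\delta_{ab}\ \text{ for all } b\in\vec I_a,\qquad \langle\overleftarrow\tau(A)_a\mid A_b\rangle=\delta_{ab}\ \text{ for all } b\in\overleftarrow I_a,$$ where $\langle v\mid w\rangle=\sum_i v_iw_i$ and $\delta_{ab}$ is $1$ if $a=b$ and $0$ otherwise. Then for every positroid $\mathcal M$ of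 rank $k$ on $[n]$ the twists $\vec\tau$ and $\overleftarrow\tau$ descend to mutually inverse regular automorphisms of $\widetilde\Pi^\circ(\mathcal M)$, and to mutually inverse regular automorphisms of $\Pi^\circ(\mathcal M)$. That is, for each of the two varieties there is a bijection $e$ of the variety onto itself such that $e$ and $e^{-1}$ are regular maps and, for every $A\in\mathrm{Mat}^\circ(\mathcal M)$, $e$ sends the class of $A$ to the class of $\vec\tau(A)$ and $e^{-1}$ sends the class of $A$ to the class of $\overleftarrow\tau(A)$. -/

import Mathlib

noncomputable section

namespace PositroidTwist

/-- The `k`-element subsets of the ground set `[n]`. -/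
abbrev KSubset (k n : ℕ) : Type := {I : Finset (Fin n) // I.card = k}

/-- The maximal minor `Δ_I(A) = det (A_{i_1}, …, A_{i_k})`, where `I = {i_1 < ⋯ < i_k}`. -/
def minor {K : Type*} [Field K] {k n : ℕ} (A : Matrix (Fin k) (Fin n) K) (I : KSubset k n) : K :=
  (A.submatrix id (I.1.orderEmbOfFin I.2)).det

/-- The column matroid of `A`, given by its collection of bases: the `k`-element sets of indices
whose columns form a basis of `K ^ k`. -/
def columnMatroid {K : Type*} [Field K] {k n : ℕ} (A : Matrix (Fin k) (Fin n) K) :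
    Set (KSubset k n) :=
  {J | LinearIndependent K (fun j : J.1 => A.col j) ∧
    Submodule.span K (Set.range fun j : J.1 => A.col j) = ⊤}

/-- A positroid of rank `k` on `[n]`: the column matroid of a real `k × n` matrix of rank `k` all of
whose maximal minors are non-negative. -/
def IsPositroid {k n : ℕ} (M : Set (KSubset k n)) : Prop :=
  ∃ B : Matrix (Fin k) (Fin n) ℝ, B.rank = k ∧ (∀ I, 0 ≤ minor B I) ∧ columnMatroid B = M

/-- The set of positions of the elements of `I` in the cyclically rotated linear order
`a ≺ a + 1 ≺ ⋯ ≺ n ≺ 1 ≺ ⋯ ≺ a - 1`; the position of `b` is `b - a` modulo `n`. -/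
def positions {k n : ℕ} (a : Fin n) (I : KSubset k n) : KSubset k n :=
  ⟨I.1.image (fun b => b - a), by
    have : NeZero n := ⟨by rintro rfl; exact a.elim0⟩
    rw [Finset.card_image_of_injective _ (sub_left_injective (b := a))]
    exact I.2⟩

/-- The partial order `B ≼_a C` on `k`-element subsets: `b_i ≼_a c_i` for all `i`, where
`B = {b_1 ≺_a ⋯ ≺_a b_k}` and `C = {c_1 ≺_a ⋯ ≺_a c_k}`. -/
def cyclicLE {k n : ℕ} (a : Fin n) (B C : KSubset k n) : Prop :=
  ∀ i : Fin k, (positions a B).1.orderEmbOfFin (positions a B).2 i ≤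
    (positions a C).1.orderEmbOfFin (positions a C).2 i

/-- `I` is the `a`-minimal basis of the matroid `M` (an entry of the Grassmann necklace). -/
def IsMinimalBasis {k n : ℕ} (M : Set (KSubset k n)) (a : Fin n) (I : KSubset k n) : Prop :=
  I ∈ M ∧ ∀ J ∈ M, cyclicLE a I J

/-- `I` is the `(a + 1)`-maximal basis of the matroid `M` (an entry of the reverse Grassmann
necklace); here `finRotate n a` is `a + 1` modulo `n`. -/
def IsMaximalBasis {k n : ℕ} (M : Set (KSubset k n)) (a : Fin n) (I : KSubset k n) : Prop :=
  I ∈ M ∧ ∀ J ∈ M, cyclicLE (finRotate n a) J I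

/-- The `a`th column of the right twist of a matrix `A` of rank `k`: the unique vector `v` with
`⟨v | A_a⟩ = 1` if `a` lies in the `a`-minimal basis, and `⟨v | A_b⟩ = 0` for all other `b` in that
basis. The pairing is the bilinear one. (The value is meaningless if `A` has rank less than `k`.) -/
def rightTwistCol {k n : ℕ} (A : Matrix (Fin k) (Fin n) ℂ) (a : Fin n) : Fin k → ℂ :=
  Classical.epsilon fun v => ∀ I, IsMinimalBasis (columnMatroid A) a I →
    ∀ b ∈ I.1, v ⬝ᵥ A.col b = if a = b then 1 else 0

/-- The `a`th column of the left twist: as for the right twist, with the `(a + 1)`-maximal basis. -/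
def leftTwistCol {k n : ℕ} (A : Matrix (Fin k) (Fin n) ℂ) (a : Fin n) : Fin k → ℂ :=
  Classical.epsilon fun v => ∀ I, IsMaximalBasis (columnMatroid A) a I →
    ∀ b ∈ I.1, v ⬝ᵥ A.col b = if a = b then 1 else 0

/-- The right twist of a `k × n` matrix of rank `k`. -/
def rightTwist {k n : ℕ} (A : Matrix (Fin k) (Fin n) ℂ) : Matrix (Fin k) (Fin n) ℂ :=
  Matrix.of fun i a => rightTwistCol A a i

/-- The left twist of a `k × n` matrix of rank `k`. -/
def leftTwist {k n : ℕ} (A : Matrix (Fin k) (Fin n) ℂ) : Matrix (Fin k) (Fin n) ℂ :=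
  Matrix.of fun i a => leftTwistCol A a i

/-- `Mat°(M)`: the complex `k × n` matrices of rank `k` whose column matroid has positroid envelope
`M`, i.e. `M` is the smallest positroid containing the column matroid. -/
def matVariety {k n : ℕ} (M : Set (KSubset k n)) : Set (Matrix (Fin k) (Fin n) ℂ) :=
  {A | A.rank = k ∧ IsLeast {P : Set (KSubset k n) | IsPositroid P ∧ columnMatroid A ⊆ P} M}

/-- The vector of Plücker coordinates of a matrix, i.e. the exterior product of its rows. -/
def pluckerVector {k n : ℕ} (A : Matrix (Fin k) (Fin n) ℂ) : KSubset k n → ℂ :=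
  fun I => minor A I

/-- The open positroid variety in the affine cone over the Plücker embedding: the image
`SL_k \ Mat°(M)` of `Mat°(M)` in the space of Plücker coordinates. -/
def conePositroidVariety {k n : ℕ} (M : Set (KSubset k n)) : Set (KSubset k n → ℂ) :=
  pluckerVector '' matVariety M

/-- The Grassmannian of `k`-dimensional subspaces of `ℂ ^ n`. -/
abbrev Gr (k n : ℕ) : Type := {V : Submodule ℂ (Fin n → ℂ) // Module.finrank ℂ V = k}

/-- The row span of a matrix. -/
def rowSpan {k n : ℕ} (A : Matrix (Fin k) (Fin n) ℂ) : Submodule ℂ (Fin n → ℂ) :=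
  Submodule.span ℂ (Set.range A.row)

/-- The open positroid variety in the Grassmannian: the row spans `GL_k \ Mat°(M)` of the matrices
in `Mat°(M)`. -/
def positroidVariety {k n : ℕ} (M : Set (KSubset k n)) : Set (Gr k n) :=
  {V | ∃ A ∈ matVariety M, rowSpan A = V.1}

/-- `p` is a vector of homogeneous (Plücker) coordinates of the point `V` of the Grassmannian. -/
def IsPluckerVectorOf {k n : ℕ} (p : KSubset k n → ℂ) (V : Gr k n) : Prop :=
  ∃ A : Matrix (Fin k) (Fin n) ℂ, rowSpan A = V.1 ∧ pluckerVector A = p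

/-- A function on a subset `X` of affine space is regular if near every point of `X` (for the Zariski
topology) it is a quotient of two polynomials with non-vanishing denominator. -/
def IsRegularFunction {ι : Type*} (X : Set (ι → ℂ)) (g : X → ℂ) : Prop :=
  ∀ x : X, ∃ P Q : MvPolynomial ι ℂ, MvPolynomial.eval x.1 Q ≠ 0 ∧
    ∀ y : X, MvPolynomial.eval y.1 Q ≠ 0 → g y = MvPolynomial.eval y.1 P / MvPolynomial.eval y.1 Q

/-- A map between subsets of affine spaces is regular if all of its coordinates are. -/
def IsRegularAffineMap {ι κ : Type*} {X : Set (ι → ℂ)} {Y : Set (κ → ℂ)} (f : X → Y) : Prop :=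
  ∀ j : κ, IsRegularFunction X (fun x => (f x).1 j)

/-- A map between subsets of the Grassmannian, embedded in projective space by the Plücker
coordinates, is regular if near every point `V₀` it is given by homogeneous polynomials `F_I` of a
common degree without common zero. The neighbourhood of `V₀` is the set where the homogeneous
polynomial `G` does not vanish. -/
def IsRegularGrMap {k n : ℕ} {X Y : Set (Gr k n)} (f : X → Y) : Prop :=
  ∀ V₀ : X, ∃ (d e : ℕ) (F : KSubset k n → MvPolynomial (KSubset k n) ℂ)
    (G : MvPolynomial (KSubset k n) ℂ),
    (∀ I, (F I).IsHomogeneous d) ∧ G.IsHomogeneous e ∧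
    (∀ p, IsPluckerVectorOf p V₀.1 → MvPolynomial.eval p G ≠ 0) ∧
    ∀ (V : X) (p q : KSubset k n → ℂ), IsPluckerVectorOf p V.1 → IsPluckerVectorOf q (f V).1 →
      MvPolynomial.eval p G ≠ 0 →
        ∃ c : ℂ, c ≠ 0 ∧ ∀ I, q I = c * MvPolynomial.eval p (F I)

end PositroidTwist

end

noncomputable section

namespace PositroidTwist

open Finset

/-! ### Dimension counts for spans of finite families. -/

section LinearAlgebra

variable {ι K V : Type*} [Field K] [AddCommGroup V] [Module K V]

/-! The defining condition of `matVariety M`, a minimality among positroids, is first turned into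
linear algebra: for a positroid `M`, a rank `k` matrix lies in `matVariety M` iff the ranks of its
columns on cyclic intervals are those prescribed by `M` (`mem_matVariety_iff`). Two facts give this.
A positroid contains every `k`-set that satisfies its cyclic interval rank bounds
(`mem_columnMatroid_of_cyclicInterval`): for a dependent set, a circuit inside it cuts the circle
into gaps, and a noncrossing property of totally nonnegative matrices forces a violated bound on the
complement of some gap. Conversely, a single satisfiable interval bound defines a positroid
(`isPositroid_cyclicInterval`), built by repeatedly adding a column to its neighbour and then
rotating by a Möbius change of variable.

The `a`-minimal and `(a + 1)`-maximal bases are the greedy bases for the two cyclic orders starting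
at `a`, and a greedy basis depends only on ranks of cyclic intervals. Hence these bases are constant
on `matVariety M`. The vectors orthogonal to the twisted columns on an interval starting at `c` are
the span of the columns of the greedy basis at `c` that lie outside the interval
(`IsTwist.annihilator`). Counting dimensions, a twist preserves all interval ranks, hence
`matVariety M` and all greedy bases. Expanding a column in a greedy basis then shows that the
duality relations also hold for the opposite order with `A` and its twist exchanged
(`IsTwist.symm`). By uniqueness the two twists are mutually inverse.

Twisting turns left multiplication by `g` into left multiplication by the inverse transpose of `g`,
so the maps descend to both quotients. For regularity, a minor of the twist times a minor of `A` is
the determinant of the pairings of their columns, and Cramer's rule makes each pairing a quotient of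
linear forms in Plücker coordinates. The bases being constant, the same formulas hold on the whole
variety. -/

theorem finrank_span_image_of_linearIndepOn {v : ι → V} {s : Finset ι}
    (hs : LinearIndepOn K v (s : Set ι)) :
    Module.finrank K (Submodule.span K (v '' (s : Set ι))) = s.card := by
  have h := finrank_span_eq_card (R := K) (b := fun i : (s : Set ι) => v i) hs
  rw [← Set.image_eq_range v (s : Set ι)] at h
  simpa using h

theorem card_le_finrank_of_linearIndepOn [FiniteDimensional K V] {v : ι → V} {s : Finset ι}
    (hs : LinearIndepOn K v (s : Set ι)) {W : Submodule K V} (hW : ∀ i ∈ s, v i ∈ W) :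
    s.card ≤ Module.finrank K W := by
  rw [← finrank_span_image_of_linearIndepOn hs]
  refine Submodule.finrank_mono (Submodule.span_le.2 ?_)
  rintro _ ⟨i, hi, rfl⟩
  exact hW i hi

theorem finrank_span_image_le_card (v : ι → V) (s : Finset ι) :
    Module.finrank K (Submodule.span K (v '' (s : Set ι))) ≤ s.card := by
  classical
  have := finrank_span_finset_le_card (R := K) (s.image v)
  rw [Set.finrank, Finset.coe_image] at this
  exact this.trans Finset.card_image_le

theorem linearIndepOn_of_span_image_eq_top [FiniteDimensional K V] {v : ι → V} {s : Finset ι}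
    (hspan : Submodule.span K (v '' (s : Set ι)) = ⊤) (hcard : s.card ≤ Module.finrank K V) :
    LinearIndepOn K v (s : Set ι) := by
  have h : s.card = Module.finrank K V := by
    refine le_antisymm hcard ?_
    rw [← finrank_top K V, ← hspan]
    exact finrank_span_image_le_card v s
  refine linearIndependent_of_top_le_span_of_card_eq_finrank (b := fun i : (s : Set ι) => v i)
    ?_ (by simpa using h)
  rw [← Set.image_eq_range v (s : Set ι), hspan]

theorem span_image_eq_top_of_linearIndepOn [FiniteDimensional K V] {v : ι → V} {s : Finset ι}
    (hs : LinearIndepOn K v (s : Set ι)) (hcard : s.card = Module.finrank K V) :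
    Submodule.span K (v '' (s : Set ι)) = ⊤ := by
  apply Submodule.eq_top_of_finrank_eq
  rw [finrank_span_image_of_linearIndepOn hs, hcard]

end LinearAlgebra

/-! ### Minors indexed by arbitrary tuples, and the column matroid. -/

section Minors

variable {K : Type*} [Field K] {k n : ℕ}

/-- The determinant of the square matrix with columns `A_{f 1}, …, A_{f k}`, in this order. -/
def detCols (A : Matrix (Fin k) (Fin n) K) (f : Fin k → Fin n) : K := (A.submatrix id f).det

theorem detCols_ne_zero_iff (A : Matrix (Fin k) (Fin n) K) (f : Fin k → Fin n) :
    detCols A f ≠ 0 ↔ LinearIndependent K (fun i => A.col (f i)) := by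
  rw [detCols, ← isUnit_iff_ne_zero, ← Matrix.isUnit_iff_isUnit_det,
    ← Matrix.linearIndependent_cols_iff_isUnit]
  rfl

theorem detCols_comp_perm (A : Matrix (Fin k) (Fin n) K) (f : Fin k → Fin n)
    (σ : Equiv.Perm (Fin k)) :
    detCols A (f ∘ σ) = (Equiv.Perm.sign σ : ℤ) * detCols A f := by
  rw [detCols, detCols, ← Matrix.det_permute' σ, Matrix.submatrix_submatrix]
  rfl

theorem detCols_eq_zero_of_not_injective (A : Matrix (Fin k) (Fin n) K) {f : Fin k → Fin n}
    (hf : ¬ Function.Injective f) : detCols A f = 0 := by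
  by_contra h
  exact hf fun i j hij => ((detCols_ne_zero_iff A f).1 h).injective (by simp [hij])

theorem exists_perm_strictMono {α β : Type*} [LinearOrder α] {x : β → α}
    (hx : Function.Injective x) {f : Fin k → β} (hf : Function.Injective f) :
    ∃ σ : Equiv.Perm (Fin k), StrictMono (x ∘ f ∘ σ) :=
  ⟨Tuple.sort (x ∘ f), (Tuple.monotone_sort (x ∘ f)).strictMono_of_injective
    ((hx.comp hf).comp (Equiv.injective _))⟩

/-- The set of values of an injective `k`-tuple. -/
def imageSubset (f : Fin k → Fin n) (hf : Function.Injective f) : KSubset k n :=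
  ⟨univ.image f, by simp [card_image_of_injective _ hf]⟩

theorem exists_detCols_eq_sign_mul_minor {f : Fin k → Fin n} (hf : Function.Injective f) :
    ∃ σ : Equiv.Perm (Fin k), ∀ A : Matrix (Fin k) (Fin n) K,
      detCols A f = (Equiv.Perm.sign σ : ℤ) * minor A (imageSubset f hf) := by
  obtain ⟨σ, hσ⟩ := exists_perm_strictMono (x := id) Function.injective_id hf
  have h : f ∘ σ = (imageSubset f hf).1.orderEmbOfFin (imageSubset f hf).2 :=
    Finset.orderEmbOfFin_unique _ (fun i => by simp [imageSubset]) hσ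
  refine ⟨σ, fun A => ?_⟩
  have h2 : minor A (imageSubset f hf) = detCols A (f ∘ σ) := by rw [h]; rfl
  rw [h2, detCols_comp_perm, ← mul_assoc, ← Int.cast_mul, ← Units.val_mul, Int.units_mul_self]
  simp

theorem mem_columnMatroid_iff_linearIndepOn (A : Matrix (Fin k) (Fin n) K) (J : KSubset k n) :
    J ∈ columnMatroid A ↔ LinearIndepOn K A.col (J.1 : Set (Fin n)) := by
  refine ⟨fun h => h.1, fun h => ⟨h, ?_⟩⟩
  have := span_image_eq_top_of_linearIndepOn h (by simp [J.2])
  rw [Set.image_eq_range] at this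
  exact this

theorem linearIndepOn_image_iff (A : Matrix (Fin k) (Fin n) K) {f : Fin k → Fin n}
    (hf : Function.Injective f) {s : Set (Fin n)} (hs : Set.range f = s) :
    LinearIndepOn K A.col s ↔ detCols A f ≠ 0 := by
  rw [detCols_ne_zero_iff, ← hs, linearIndepOn_range_iff hf]
  rfl

theorem mem_columnMatroid_iff_minor (A : Matrix (Fin k) (Fin n) K) (J : KSubset k n) :
    J ∈ columnMatroid A ↔ minor A J ≠ 0 := by
  rw [mem_columnMatroid_iff_linearIndepOn]
  exact linearIndepOn_image_iff A (J.1.orderEmbOfFin J.2).injective (by simp)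

theorem imageSubset_mem_columnMatroid_iff (A : Matrix (Fin k) (Fin n) K) {f : Fin k → Fin n}
    (hf : Function.Injective f) : imageSubset f hf ∈ columnMatroid A ↔ detCols A f ≠ 0 := by
  rw [mem_columnMatroid_iff_linearIndepOn]
  exact linearIndepOn_image_iff A hf (by simp [imageSubset])

theorem span_range_col_eq_top_iff (A : Matrix (Fin k) (Fin n) K) :
    Submodule.span K (Set.range A.col) = ⊤ ↔ A.rank = k := by
  rw [Matrix.rank_eq_finrank_span_cols]
  refine ⟨fun h => by rw [h]; simp, fun h => Submodule.eq_top_of_finrank_eq (by simpa using h)⟩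

theorem rank_eq_of_mem_columnMatroid {A : Matrix (Fin k) (Fin n) K} {J : KSubset k n}
    (hJ : J ∈ columnMatroid A) : A.rank = k := by
  rw [← span_range_col_eq_top_iff, eq_top_iff, ← hJ.2]
  exact Submodule.span_mono (by rintro _ ⟨j, rfl⟩; exact ⟨j, rfl⟩)

end Minors

/-! ### Total nonnegativity with respect to an ordering of the columns -/

section TotallyNonneg

variable {k n : ℕ}

/-- All maximal minors of `B` are nonnegative when the columns are ordered by the values of `x`. -/
def IsTotallyNonneg (x : Fin n → ℝ) (B : Matrix (Fin k) (Fin n) ℝ) : Prop :=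
  ∀ f : Fin k → Fin n, 0 ≤ detCols B f * (Matrix.vandermonde (x ∘ f)).det

theorem det_vandermonde_pos {y : Fin k → ℝ} (hy : StrictMono y) :
    0 < (Matrix.vandermonde y).det := by
  rw [Matrix.det_vandermonde]
  refine prod_pos fun i _ => prod_pos fun j hj => sub_pos.2 (hy ?_)
  simpa using hj

theorem det_vandermonde_comp_perm (y : Fin k → ℝ) (σ : Equiv.Perm (Fin k)) :
    (Matrix.vandermonde (y ∘ σ)).det = (Equiv.Perm.sign σ : ℤ) * (Matrix.vandermonde y).det := by
  rw [← Matrix.det_permute σ]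
  rfl

/-- Both factors in the definition alternate under permutations of the tuple, so their product is
symmetric and sorted tuples suffice. The Vandermonde factor serves as a sign that makes sense for
every ordering and transforms well under changes of `x`. -/
theorem isTotallyNonneg_iff {x : Fin n → ℝ} (hx : Function.Injective x)
    {B : Matrix (Fin k) (Fin n) ℝ} :
    IsTotallyNonneg x B ↔ ∀ f : Fin k → Fin n, StrictMono (x ∘ f) → 0 ≤ detCols B f := by
  refine ⟨fun h f hf => ?_, fun h f => ?_⟩
  · exact nonneg_of_mul_nonneg_left (h f) (det_vandermonde_pos hf)
  · by_cases hf : Function.Injective f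
    · obtain ⟨σ, hσ⟩ := exists_perm_strictMono hx hf
      have h1 : 0 ≤ detCols B (f ∘ σ) * (Matrix.vandermonde ((x ∘ f) ∘ σ)).det :=
        mul_nonneg (h _ hσ) (det_vandermonde_pos hσ).le
      rw [detCols_comp_perm, det_vandermonde_comp_perm, mul_mul_mul_comm, ← Int.cast_mul,
        ← Units.val_mul, Int.units_mul_self] at h1
      simpa using h1
    · simp [detCols_eq_zero_of_not_injective B hf]

theorem IsTotallyNonneg.pos {x : Fin n → ℝ} (hx : Function.Injective x)
    {B : Matrix (Fin k) (Fin n) ℝ} (hB : IsTotallyNonneg x B) {f : Fin k → Fin n}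
    (hf : detCols B f ≠ 0) : 0 < detCols B f * (Matrix.vandermonde (x ∘ f)).det := by
  refine lt_of_le_of_ne (hB f) (mul_ne_zero hf ?_).symm
  rw [Matrix.det_vandermonde_ne_zero_iff]
  refine hx.comp ?_
  by_contra h
  exact hf (detCols_eq_zero_of_not_injective B h)

/-- The standard ordering of the columns. -/
def stdOrder (n : ℕ) (j : Fin n) : ℝ := (j : ℕ)

theorem stdOrder_strictMono : StrictMono (stdOrder n) := fun i j h => by
  simpa [stdOrder] using h

theorem isTotallyNonneg_stdOrder_iff {B : Matrix (Fin k) (Fin n) ℝ} :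
    IsTotallyNonneg (stdOrder n) B ↔ ∀ I, 0 ≤ minor B I := by
  rw [isTotallyNonneg_iff stdOrder_strictMono.injective]
  refine ⟨fun h I => h _ (stdOrder_strictMono.comp (I.1.orderEmbOfFin I.2).strictMono),
    fun h f hf => ?_⟩
  have hf' : StrictMono f := fun i j hij => stdOrder_strictMono.lt_iff_lt.1 (hf hij)
  have h1 := h (imageSubset f hf'.injective)
  have h2 : f = (imageSubset f hf'.injective).1.orderEmbOfFin (imageSubset f hf'.injective).2 :=
    Finset.orderEmbOfFin_unique _ (fun i => by simp [imageSubset]) hf'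
  rw [h2]
  exact h1

theorem isPositroid_iff {M : Set (KSubset k n)} :
    IsPositroid M ↔ ∃ B : Matrix (Fin k) (Fin n) ℝ,
      B.rank = k ∧ IsTotallyNonneg (stdOrder n) B ∧ columnMatroid B = M := by
  simp only [IsPositroid, isTotallyNonneg_stdOrder_iff]

end TotallyNonneg

/-! ### Coordinates in independent families, and extension to a basis. -/

section LinearAlgebra

variable {ι K V : Type*} [Field K] [AddCommGroup V] [Module K V]

/-- Coordinates with respect to an independent family are unique, so the coordinates that can be
made to vanish one at a time vanish together. -/
theorem mem_span_image_diff_of_forall {v : ι → V} {X Y : Set ι} {w : V}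
    (hX : LinearIndepOn K v X) (hw : w ∈ Submodule.span K (v '' X))
    (h : ∀ b ∈ Y, w ∈ Submodule.span K (v '' (X \ {b}))) :
    w ∈ Submodule.span K (v '' (X \ Y)) := by
  rw [linearIndepOn_iff] at hX
  rw [Finsupp.mem_span_image_iff_linearCombination] at hw ⊢
  obtain ⟨l, hl, rfl⟩ := hw
  refine ⟨l, ?_, rfl⟩
  rw [Finsupp.mem_supported] at hl ⊢
  refine fun i hi => ⟨hl hi, fun hiY => ?_⟩
  obtain ⟨l', hl', h'⟩ := (Finsupp.mem_span_image_iff_linearCombination _).1 (h i hiY)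
  have h0 : l - l' = 0 := by
    refine hX _ (Submodule.sub_mem _ (by rwa [Finsupp.mem_supported])
      (Finsupp.supported_mono Set.sdiff_subset hl')) ?_
    rw [map_sub, h', sub_self]
  rw [sub_eq_zero] at h0
  subst h0
  exact (hl' hi).2 rfl

theorem exists_finset_extend_linearIndepOn [Finite ι] {v : ι → V} {S : Finset ι}
    (hS : LinearIndepOn K v (S : Set ι)) :
    ∃ E : Finset ι, S ⊆ E ∧ LinearIndepOn K v (E : Set ι) ∧
      Submodule.span K (v '' (E : Set ι)) = Submodule.span K (Set.range v) := by
  have hfin : (hS.extend (Set.subset_univ _)).Finite := Set.toFinite _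
  refine ⟨hfin.toFinset, ?_, ?_, ?_⟩
  · have := hS.subset_extend (Set.subset_univ _)
    rwa [Set.Finite.subset_toFinset]
  · rw [Set.Finite.coe_toFinset]
    exact hS.linearIndepOn_extend (Set.subset_univ _)
  · rw [Set.Finite.coe_toFinset, hS.span_image_extend_eq_span_image (Set.subset_univ _),
      Set.image_univ]

end LinearAlgebra

/-! ### Cyclic intervals -/

section Cyclic

variable {n : ℕ}

theorem val_sub_cases (a b : Fin n) :
    (b.val ≤ a.val ∧ (a - b).val = a.val - b.val) ∨
      (a.val < b.val ∧ (a - b).val = n + a.val - b.val) := by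
  rcases le_or_gt b a with h | h
  · exact Or.inl ⟨h, Fin.sub_val_of_le h⟩
  · exact Or.inr ⟨h, Fin.coe_sub_iff_lt.2 h⟩

/-- The cyclic interval of length `m` starting at `a`. -/
def cyclicInterval (a : Fin n) (m : ℕ) : Finset (Fin n) := univ.filter fun b => (b - a).val < m

@[simp] theorem mem_cyclicInterval {a b : Fin n} {m : ℕ} :
    b ∈ cyclicInterval a m ↔ (b - a).val < m := by simp [cyclicInterval]

/-- The elements outside `C` whose cyclic predecessor in `C` is `c`. -/
def gap (C : Finset (Fin n)) (c : Fin n) : Finset (Fin n) :=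
  univ.filter fun b => b ∉ C ∧ ∀ c' ∈ C, (b - c).val ≤ (b - c').val

theorem mem_gap {C : Finset (Fin n)} {b c : Fin n} :
    b ∈ gap C c ↔ b ∉ C ∧ ∀ c' ∈ C, (b - c).val ≤ (b - c').val := by simp [gap]

theorem gap_eq_compl_cyclicInterval {C : Finset (Fin n)} {c : Fin n} (hc : c ∈ C) :
    ∃ a m, ∀ e, e ∈ gap C c ↔ e ∉ cyclicInterval a m := by
  rcases Nat.lt_or_ge n 2 with hn | hn
  · refine ⟨c, n, fun e => ?_⟩
    have : e = c := by ext; omega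
    subst this
    simp [mem_gap, hc]
  have : NeZero n := ⟨by omega⟩
  -- Here `c₁` is the cyclic successor of `c` in `C`. Counting from `c + 1` puts `c` last, so `c₁ =
  -- c` only when `C` is a singleton. The complement of the gap is the interval from `c₁` through
  -- `c`.
  obtain ⟨c₁, hc₁, hmin⟩ := exists_min_image C (fun x => (x - (c + 1)).val) ⟨c, hc⟩
  have h1 : (c + 1).val = if c.val + 1 = n then 0 else c.val + 1 := by
    obtain ⟨m, rfl⟩ : ∃ m, n = m + 1 := ⟨n - 1, by omega⟩
    rw [Fin.val_add_one]
    simp [Fin.ext_iff]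
  refine ⟨c₁, (c - c₁).val + 1, fun e => ?_⟩
  rw [mem_gap, mem_cyclicInterval, not_lt]
  constructor
  · rintro ⟨he, h⟩
    have h2 := h c₁ hc₁
    have h3 : e ≠ c₁ := fun h => he (h ▸ hc₁)
    have h3' : e ≠ c := fun h => he (h ▸ hc)
    rw [Ne, Fin.ext_iff] at h3 h3'
    have := val_sub_cases e c
    have := val_sub_cases e c₁
    have := val_sub_cases c c₁
    omega
  · intro h
    have h2 := hmin c hc
    constructor
    · intro he
      have h3 := hmin e he
      have := val_sub_cases e (c + 1)
      have := val_sub_cases c₁ (c + 1)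
      have := val_sub_cases e c₁
      have := val_sub_cases c c₁
      split_ifs at h1 <;> omega
    · intro c' hc'
      have h3 := hmin c' hc'
      have := val_sub_cases c' (c + 1)
      have := val_sub_cases c₁ (c + 1)
      have := val_sub_cases e c₁
      have := val_sub_cases c c₁
      have := val_sub_cases e c
      have := val_sub_cases e c'
      split_ifs at h1 <;> omega

theorem exists_mem_gap {C : Finset (Fin n)} (hC : C.Nonempty) {b : Fin n} (hb : b ∉ C) :
    ∃ c ∈ C, b ∈ gap C c := by
  obtain ⟨c, hc, h⟩ := exists_min_image C (fun c => (b - c).val) hC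
  exact ⟨c, hc, mem_gap.2 ⟨hb, h⟩⟩

theorem sub_val_injective_left (b : Fin n) {c c' : Fin n} (h : (b - c).val = (b - c').val) :
    c = c' := by
  have := val_sub_cases b c
  have := val_sub_cases b c'
  ext
  omega

theorem gap_unique {C : Finset (Fin n)} {b c c' : Fin n} (hc : c ∈ C) (hc' : c' ∈ C)
    (h : b ∈ gap C c) (h' : b ∈ gap C c') : c = c' :=
  sub_val_injective_left b
    (le_antisymm ((mem_gap.1 h).2 _ hc') ((mem_gap.1 h').2 _ hc))

theorem card_sdiff_eq_sum_gap {C : Finset (Fin n)} (hC : C.Nonempty) (X : Finset (Fin n)) :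
    (X \ C).card = ∑ c ∈ C, (X ∩ gap C c).card := by
  rw [← card_biUnion]
  · congr 1
    ext b
    simp only [mem_sdiff, mem_biUnion, mem_inter]
    constructor
    · rintro ⟨h1, h2⟩
      obtain ⟨c, hc, h⟩ := exists_mem_gap hC h2
      exact ⟨c, hc, h1, h⟩
    · rintro ⟨c, -, h1, h2⟩
      exact ⟨h1, (mem_gap.1 h2).1⟩
  · intro c hc c' hc' hne
    refine disjoint_left.2 fun b h h' => hne ?_
    exact gap_unique hc hc' (mem_inter.1 h).2 (mem_inter.1 h').2

theorem sub_val_le_sub_val_iff {b c c' : Fin n} (h : b.val ≠ c.val) (h' : b.val ≠ c'.val) :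
    (b - c).val ≤ (b - c').val ↔ c.val < b.val ∧ (c'.val ≤ c.val ∨ b.val < c'.val) ∨
      b.val < c.val ∧ b.val < c'.val ∧ c'.val ≤ c.val := by
  have := val_sub_cases b c
  have := val_sub_cases b c'
  omega

/-- The witness is the first element of `C` after `b`: the gap of `c` is the open arc between these
two, and `d` lies on the other arc. The conclusion is phrased in the linear order: exactly one of
`b`, `d` lies between `c` and `c'`. -/
theorem exists_separating_of_gap {C : Finset (Fin n)} {c b d : Fin n} (hc : c ∈ C)
    (hb : b ∈ gap C c) (hdC : d ∉ C) (hd : d ∉ gap C c) :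
    ∃ c' ∈ C, c' ≠ c ∧ ((b < c ∧ b < c' ∨ c < b ∧ c' < b) ∧ (d < c ∧ c' < d ∨ c < d ∧ d < c') ∨
      (d < c ∧ d < c' ∨ c < d ∧ c' < d) ∧ (b < c ∧ c' < b ∨ c < b ∧ b < c')) := by
  obtain ⟨c₁, hc₁, hmin⟩ := exists_min_image C (fun x => (x - b).val) ⟨c, hc⟩
  rw [mem_gap] at hb hd
  obtain ⟨hbC, hb⟩ := hb
  push Not at hd
  obtain ⟨c₂, hc₂, h2⟩ := hd hdC
  have h3 := hb c₁ hc₁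
  have h4 := hb c₂ hc₂
  have h5 := hmin c hc
  have h6 := hmin c₂ hc₂
  have ne : ∀ x ∉ C, ∀ y ∈ C, x.val ≠ y.val := fun x hx y hy h => hx (Fin.ext h ▸ hy)
  have n1 := ne b hbC c hc
  have n2 := ne b hbC c₁ hc₁
  have n3 := ne b hbC c₂ hc₂
  have n4 := ne d hdC c hc
  have n5 := ne d hdC c₁ hc₁
  have n6 := ne d hdC c₂ hc₂
  clear ne hmin hb
  have hne : c₁.val ≠ c.val := by
    intro h
    obtain rfl := Fin.ext h
    obtain rfl : c₂ = c₁ := by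
      have := val_sub_cases b c₁
      have := val_sub_cases b c₂
      have := val_sub_cases c₁ b
      have := val_sub_cases c₂ b
      ext
      omega
    omega
  have f1 := (sub_val_le_sub_val_iff n1 n3).1 h4
  have f2 := (sub_val_le_sub_val_iff n4 n6).not.1 (not_le.2 h2)
  have f3 : b.val < c₁.val ∧ (c₂.val < b.val ∨ c₁.val ≤ c₂.val) ∨
      c₁.val < b.val ∧ c₂.val < b.val ∧ c₁.val ≤ c₂.val := by
    have := val_sub_cases c₁ b
    have := val_sub_cases c₂ b
    omega
  have f4 : b.val < c₁.val ∧ (c.val < b.val ∨ c₁.val ≤ c.val) ∨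
      c₁.val < b.val ∧ c.val < b.val ∧ c₁.val ≤ c.val := by
    have := val_sub_cases c₁ b
    have := val_sub_cases c b
    omega
  clear h2 h3 h4 h5 h6
  refine ⟨c₁, hc₁, fun h => hne (by rw [h]), ?_⟩
  simp only [Fin.lt_def]
  rcases lt_or_gt_of_ne n1 with g1 | g1 <;>
  rcases lt_or_gt_of_ne n2 with g2 | g2 <;>
  rcases lt_or_gt_of_ne n4 with g4 | g4 <;>
  rcases lt_or_gt_of_ne n5 with g5 | g5 <;>
  simp only [g1, g2, g4, g5, g1.not_gt, g2.not_gt, g4.not_gt, g5.not_gt, and_true, and_false,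
    or_false, or_true, and_self, or_self] <;> omega

end Cyclic

/-! ### Noncrossing property of totally nonnegative matrices -/

section Noncrossing

variable {k n : ℕ}

theorem det_vandermonde_cons_cons {m : ℕ} (a b : ℝ) (z : Fin m → ℝ) :
    (Matrix.vandermonde (Fin.cons a (Fin.cons b z : Fin (m + 1) → ℝ) : Fin (m + 2) → ℝ)).det =
      (b - a) * (∏ i, (z i - a)) * (∏ i, (z i - b)) * (Matrix.vandermonde z).det := by
  simp only [Matrix.det_vandermonde, Fin.prod_univ_succ, Fin.prod_Ioi_zero, Fin.prod_Ioi_succ,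
    Fin.cons_zero, Fin.cons_succ]
  ring

theorem detCols_cons_cons_ne_zero {m : ℕ} {B : Matrix (Fin (m + 2)) (Fin n) ℝ}
    {S : Finset (Fin n)} (hS : S.card = m) {a b : Fin n} (ha : a ∉ S) (hb : b ∉ S) (hab : a ≠ b)
    (h : LinearIndepOn ℝ B.col (insert a (insert b S) : Set (Fin n))) :
    detCols B (Fin.cons a (Fin.cons b (S.orderEmbOfFin hS) : Fin (m + 1) → Fin n)) ≠ 0 := by
  refine (linearIndepOn_image_iff B ?_ ?_).1 h
  · rw [Fin.cons_injective_iff, Fin.cons_injective_iff]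
    refine ⟨?_, ?_, (S.orderEmbOfFin hS).injective⟩
    · simp [Fin.range_cons, hab, ha]
    · simp [hb]
  · simp [Fin.range_cons]

/-- If `S ∪ {a, c}` is dependent and `S ∪ {a, b}`, `S ∪ {c, b}`, `S ∪ {a, d}`, `S ∪ {c, d}` are bases
of a totally nonnegative matrix, then the pairs `a, c` and `b, d` do not cross. -/
theorem noncrossing_of_dependent {x : Fin n → ℝ} (hx : Function.Injective x)
    {B : Matrix (Fin k) (Fin n) ℝ} (hB : IsTotallyNonneg x B) {S : Finset (Fin n)}
    (hS : S.card + 2 = k) {a b c d : Fin n} (ha : a ∉ S) (hb : b ∉ S) (hc : c ∉ S) (hd : d ∉ S)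
    (hac : a ≠ c) (hab : a ≠ b) (had : a ≠ d) (hcb : c ≠ b) (hcd : c ≠ d)
    (dac : ¬ LinearIndepOn ℝ B.col (insert a (insert c S) : Set (Fin n)))
    (iab : LinearIndepOn ℝ B.col (insert a (insert b S) : Set (Fin n)))
    (iad : LinearIndepOn ℝ B.col (insert a (insert d S) : Set (Fin n)))
    (icb : LinearIndepOn ℝ B.col (insert c (insert b S) : Set (Fin n)))
    (icd : LinearIndepOn ℝ B.col (insert c (insert d S) : Set (Fin n))) :
    0 < ((x b - x a) * (x b - x c)) * ((x d - x a) * (x d - x c)) := by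
  obtain ⟨m, rfl⟩ : ∃ m, k = m + 2 := ⟨k - 2, by omega⟩
  have hS' : S.card = m := by omega
  set s := S.orderEmbOfFin hS' with hs
  have hrel : ∃ μ : Fin n → ℝ, ∑ i ∈ insert a (insert c S), μ i • B.col i = 0 ∧
      ∃ i ∈ insert a (insert c S), μ i ≠ 0 := by
    have := dac
    rw [← coe_insert, ← coe_insert, linearIndepOn_finset_iff] at this
    push Not at this
    exact this
  obtain ⟨μ, hμ, i₀, hi₀, hi₀'⟩ := hrel
  set F : Fin n → Fin n → ℝ := fun p q => detCols B (Fin.cons p (Fin.cons q s : Fin (m + 1) → Fin n))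
    with hF
  -- Apply the linear functional "determinant with the first column replaced" to the dependency; the
  -- terms from `S` vanish because they repeat a column.
  have key : ∀ y, μ a * F a y + μ c * F c y = 0 := by
    intro y
    have hcr : ∀ p, F p y = Matrix.cramer
        (B.submatrix id (Fin.cons a (Fin.cons y s : Fin (m + 1) → Fin n))) (B.col p) 0 := by
      intro p
      rw [Matrix.cramer_apply, hF]
      simp only [detCols]
      congr 1
      ext i j
      refine Fin.cases ?_ (fun j => ?_) j
      · simp [Matrix.col]
      · simp
    have h0 : ∑ i ∈ insert a (insert c S), μ i * F i y = 0 := by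
      have h := congrArg (fun w => Matrix.cramer
        (B.submatrix id (Fin.cons a (Fin.cons y s : Fin (m + 1) → Fin n))) w 0) hμ
      simp only [map_sum, map_smul, map_zero, Pi.zero_apply, Finset.sum_apply, Pi.smul_apply,
        smul_eq_mul] at h
      simpa only [hcr] using h
    rw [sum_insert (by simp [ha, hac]), sum_insert hc, sum_eq_zero, add_zero] at h0
    · exact h0
    · intro i hi
      rw [hF]
      simp only
      rw [detCols_eq_zero_of_not_injective, mul_zero]
      rw [Fin.cons_injective_iff]
      rintro ⟨h, -⟩
      apply h
      rw [Fin.range_cons]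
      right
      rw [hs]
      simpa using hi
  have nab : F a b ≠ 0 := detCols_cons_cons_ne_zero hS' ha hb hab iab
  have nad : F a d ≠ 0 := detCols_cons_cons_ne_zero hS' ha hd had iad
  have ncb : F c b ≠ 0 := detCols_cons_cons_ne_zero hS' hc hb hcb icb
  have ncd : F c d ≠ 0 := detCols_cons_cons_ne_zero hS' hc hd hcd icd
  have hμa : μ a ≠ 0 := by
    intro h
    have hμc : μ c = 0 := by
      have := key b
      rw [h, zero_mul, zero_add] at this
      exact (mul_eq_zero.1 this).resolve_right ncb
    have hSi : LinearIndepOn ℝ B.col (S : Set (Fin n)) :=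
      iab.mono ((Set.subset_insert _ _).trans (Set.subset_insert _ _))
    rw [linearIndepOn_finset_iff] at hSi
    rw [sum_insert (by simp [ha, hac]), sum_insert hc, h, hμc, zero_smul, zero_smul, zero_add,
      zero_add] at hμ
    have := hSi μ hμ
    simp only [mem_insert] at hi₀
    rcases hi₀ with rfl | rfl | hi₀
    · exact hi₀' h
    · exact hi₀' hμc
    · exact hi₀' (this _ hi₀)
  set V := (Matrix.vandermonde (x ∘ s)).det
  set P : Fin n → ℝ := fun p => ∏ i, (x (s i) - x p) with hP
  have pos : ∀ p q, F p q ≠ 0 → 0 < F p q * ((x q - x p) * P p * P q * V) := by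
    intro p q h
    have h1 := hB.pos hx h
    rw [show x ∘ (Fin.cons p (Fin.cons q s : Fin (m + 1) → Fin n) : Fin (m + 2) → Fin n) =
      (Fin.cons (x p) (Fin.cons (x q) (x ∘ s) : Fin (m + 1) → ℝ) : Fin (m + 2) → ℝ) by
        rw [← Fin.comp_cons, ← Fin.comp_cons], det_vandermonde_cons_cons] at h1
    exact h1
  obtain ⟨t, ht⟩ : ∃ t : ℝ, ∀ y, F a y = t * F c y := by
    refine ⟨-(μ c / μ a), fun y => ?_⟩
    have := key y
    field_simp
    linarith
  -- Since `F a` is proportional to `F c`, the product of the four positive quantities is a square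
  -- times the four differences in the goal: each `P`-factor occurs twice and `V` four times.
  have h1 := mul_pos (mul_pos (pos a b nab) (pos c b ncb)) (mul_pos (pos a d nad) (pos c d ncd))
  rw [ht b, ht d] at h1
  by_contra hneg
  have h2 := mul_nonneg (neg_nonneg.2 (not_lt.1 hneg))
    (sq_nonneg (t * F c b * F c d * P a * P c * P b * P d * V ^ 2))
  linarith

end Noncrossing

/-! ### Positroids are cut out by cyclic interval ranks. -/

section RankConditions

variable {k n : ℕ}

theorem not_linearIndepOn_iff_mem_span {ι K V : Type*} [Field K] [AddCommGroup V] [Module K V]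
    [DecidableEq ι] {v : ι → V} {C : Finset ι} {c : ι} (hc : c ∈ C)
    (h : LinearIndepOn K v (C.erase c : Set ι)) :
    ¬ LinearIndepOn K v (C : Set ι) ↔ v c ∈ Submodule.span K (v '' (C.erase c : Set ι)) := by
  have h2 : (C : Set ι) = insert c (C.erase c : Set ι) := by
    rw [← coe_insert, insert_erase hc]
  rw [h2, linearIndepOn_insert (by simp)]
  tauto

/-- A set satisfying all rank conditions imposed by cyclic intervals is a basis of the column matroid
of a totally nonnegative matrix. -/
theorem mem_columnMatroid_of_cyclicInterval {B : Matrix (Fin k) (Fin n) ℝ} (hr : B.rank = k)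
    (hB : IsTotallyNonneg (stdOrder n) B) {J : KSubset k n}
    (hJ : ∀ a m r, (∀ J' ∈ columnMatroid B, (J'.1 ∩ cyclicInterval a m).card ≤ r) →
      (J.1 ∩ cyclicInterval a m).card ≤ r) : J ∈ columnMatroid B := by
  rw [mem_columnMatroid_iff_linearIndepOn]
  by_contra hdep
  set v := B.col with hv
  -- `C` is a circuit contained in the dependent set `J`.
  obtain ⟨C, hCJ, hC, hCmin⟩ := exists_minimal_le_of_wellFoundedLT
    (fun S : Finset (Fin n) => ¬ LinearIndepOn ℝ v (S : Set (Fin n))) J.1 hdep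
  have herase : ∀ c ∈ C, LinearIndepOn ℝ v (C.erase c : Set (Fin n)) := by
    intro c hc
    by_contra h
    exact (mem_erase.1 (hCmin h (erase_subset c C) hc)).1 rfl
  have hmem : ∀ c ∈ C, v c ∈ Submodule.span ℝ (v '' (C.erase c : Set (Fin n))) :=
    fun c hc => (not_linearIndepOn_iff_mem_span hc (herase c hc)).1 hC
  have hCne : C.Nonempty := by
    rw [nonempty_iff_ne_empty]
    rintro rfl
    exact hC (by simp)
  have hspan : ∀ c ∈ C, ∀ Y : Set (Fin n), Submodule.span ℝ (v '' (C.erase c ∪ Y)) =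
      Submodule.span ℝ (v '' (C ∪ Y)) := by
    intro c hc Y
    apply le_antisymm
    · exact Submodule.span_mono (Set.image_mono
        (Set.union_subset_union_left _ (by simp)))
    · rw [Submodule.span_le]
      rintro _ ⟨i, hi, rfl⟩
      by_cases hic : i = c
      · subst hic
        exact Submodule.span_mono (Set.image_mono Set.subset_union_left) (hmem i hc)
      · refine Submodule.subset_span ⟨i, ?_, rfl⟩
        rcases hi with hi | hi
        · exact Or.inl (by simpa [hic] using hi)
        · exact Or.inr hi
  obtain ⟨c₀, hc₀⟩ := hCne
  obtain ⟨E, hE, hEi, hEs⟩ := exists_finset_extend_linearIndepOn (herase c₀ hc₀)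
  rw [(span_range_col_eq_top_iff B).2 hr] at hEs
  have hEcard : E.card = k := by
    have := finrank_span_image_of_linearIndepOn hEi
    rw [hEs] at this
    simpa using this.symm
  set T := E \ C.erase c₀ with hT
  have hTE : C.erase c₀ ∪ T = E := by rw [hT, union_sdiff_of_subset hE]
  have hc₀E : c₀ ∉ E := fun h => hC (hEi.mono (by
    rw [coe_subset, ← insert_erase hc₀]
    exact insert_subset h hE))
  have hTC : Disjoint C T := by
    rw [disjoint_left]
    intro c hc hcT
    rw [hT, mem_sdiff, mem_erase] at hcT
    by_cases h : c = c₀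
    · exact hc₀E (h ▸ hcT.1)
    · exact hcT.2 ⟨h, hc⟩
  have hTcard : T.card + C.card = k + 1 := by
    have h1 := card_sdiff_add_card_eq_card hE
    rw [card_erase_of_mem hc₀, ← hT] at h1
    have := card_pos.2 ⟨c₀, hc₀⟩
    omega
  have hbasis : ∀ c ∈ C, LinearIndepOn ℝ v (C.erase c ∪ T : Set (Fin n)) := by
    intro c hc
    have := linearIndepOn_of_span_image_eq_top (K := ℝ) (v := v) (s := C.erase c ∪ T) (by
      rw [coe_union, hspan c hc, ← hspan c₀ hc₀, ← coe_union, hTE, hEs]) (by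
      have h1 := card_union_le (C.erase c) T
      rw [card_erase_of_mem hc] at h1
      have := card_pos.2 ⟨c₀, hc₀⟩
      simp
      omega)
    rwa [coe_union] at this
  -- `T` completes the circuit minus any one element to a basis, so it has one element more than `J`
  -- has outside `C`; hence some gap of `C` contains more of `T` than of `J`.
  have hlt : (J.1 \ C).card < (T \ C).card := by
    rw [card_sdiff_of_subset hCJ, J.2, sdiff_eq_self_of_disjoint hTC.symm]
    have := card_pos.2 ⟨c₀, hc₀⟩
    have := card_le_card hCJ
    rw [J.2] at this
    omega
  rw [card_sdiff_eq_sum_gap ⟨c₀, hc₀⟩, card_sdiff_eq_sum_gap ⟨c₀, hc₀⟩] at hlt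
  obtain ⟨c, hc, hclt⟩ := exists_lt_of_sum_lt hlt
  obtain ⟨a, m, hgap⟩ := gap_eq_compl_cyclicInterval hc
  -- Main claim: columns outside this gap need no basis vector inside it. This bounds the rank of
  -- the complementary interval by `k` minus the number of elements of `T` in the gap, which `J`
  -- exceeds.
  have hsp : ∀ d ∈ cyclicInterval a m,
      v d ∈ Submodule.span ℝ (v '' ((C.erase c ∪ T : Set (Fin n)) \ gap C c)) := by
    intro d hd
    have hdgap : d ∉ gap C c := fun h => (hgap d).1 h hd
    refine mem_span_image_diff_of_forall (hbasis c hc) ?_ ?_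
    · rw [hspan c hc, ← hspan c₀ hc₀, ← coe_union, hTE, hEs]
      trivial
    intro b hb
    rw [mem_coe] at hb
    have hbC := (mem_gap.1 hb).1
    by_cases hbT : b ∈ T
    swap
    · rw [Set.sdiff_singleton_eq_self (by simp [hbC, hbT]), hspan c hc, ← hspan c₀ hc₀,
        ← coe_union, hTE, hEs]
      trivial
    have hset : ∀ c ∈ C, (C.erase c ∪ T : Set (Fin n)) \ {b} =
        (C.erase c : Set (Fin n)) ∪ (T.erase b : Set (Fin n)) := by
      intro c hc
      ext i
      by_cases hib : i = b
      · subst hib; simp [hbC]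
      · simp [hib]
    rw [hset c hc, hspan c hc]
    by_contra hdspan
    have hdC : d ∉ C := fun h => hdspan (Submodule.subset_span ⟨d, Or.inl h, rfl⟩)
    have hdT : d ∉ T.erase b := fun h => hdspan (Submodule.subset_span ⟨d, Or.inr h, rfl⟩)
    -- If `d` needed `b`, the pairs `c, c'` and `b, d` would cross over the common set `S` of size
    -- `k - 2`. There `c, c'` gives a dependent set because it contains `C`, and the four mixed
    -- pairs give bases, contrary to noncrossing.
    obtain ⟨c', hc', hne, hsep⟩ := exists_separating_of_gap hc hb hdC hdgap
    set S := ((C.erase c).erase c') ∪ T.erase b with hS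
    have hSC : ∀ p ∈ C, ∀ q ∈ C, p ≠ q → ((C.erase p).erase q) ∪ T.erase b = S →
        ∀ e, insert q (insert e S : Set (Fin n)) = insert e
          ((C.erase p : Set (Fin n)) ∪ (T.erase b : Set (Fin n))) := by
      rintro p hp q hq hpq hpS e
      rw [← hpS, Set.insert_comm]
      congr 1
      rw [coe_union, ← Set.insert_union, ← coe_insert, insert_erase (by simp [hq, hpq.symm])]
    have hdT' : ∀ e, e ∈ T → e ∉ C := fun e he h => disjoint_left.1 hTC h he
    have hib : ∀ p ∈ C, LinearIndepOn ℝ v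
        (insert b ((C.erase p : Set (Fin n)) ∪ (T.erase b : Set (Fin n)))) := by
      intro p hp
      refine (hbasis p hp).mono ?_
      rintro i (rfl | hi | hi)
      · exact Or.inr hbT
      · exact Or.inl hi
      · exact Or.inr (mem_of_mem_erase hi)
    have hid : ∀ p ∈ C, LinearIndepOn ℝ v
        (insert d ((C.erase p : Set (Fin n)) ∪ (T.erase b : Set (Fin n)))) := by
      intro p hp
      rw [linearIndepOn_insert (by
        rintro (h | h)
        · exact hdC (mem_of_mem_erase h)
        · exact hdT h), hspan p hp]
      exact ⟨(hib p hp).mono (Set.subset_insert _ _), hdspan⟩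
    have hScard : S.card + 2 = k := by
      rw [hS, card_union_of_disjoint (by
        rw [disjoint_left]
        intro e he he'
        exact hdT' e (mem_of_mem_erase he') (mem_of_mem_erase (mem_of_mem_erase he))),
        card_erase_of_mem (by simp [hc', hne]), card_erase_of_mem hc, card_erase_of_mem hbT]
      have := card_pos.2 ⟨b, hbT⟩
      have : 2 ≤ C.card := one_lt_card.2 ⟨c, hc, c', hc', hne.symm⟩
      omega
    have hS' : ((C.erase c').erase c) ∪ T.erase b = S := by rw [hS, erase_right_comm]
    have := noncrossing_of_dependent stdOrder_strictMono.injective hB (S := S) (k := k) hScard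
      (a := c) (c := c') (b := b) (d := d)
      (by simpa [hS] using fun _ h => hdT' c h hc)
      (by simp [hS, hbC])
      (by simpa [hS] using fun _ h => hdT' c' h hc')
      (by simp only [hS, mem_union, not_or]; exact ⟨by simp [hdC], hdT⟩)
      hne.symm (fun h => hbC (h ▸ hc)) (fun h => hdC (h ▸ hc)) (fun h => hbC (h ▸ hc'))
      (fun h => hdC (h ▸ hc'))
      (fun h => hC (h.mono (by
        intro i hi
        by_cases h1 : i = c
        · exact Or.inl h1
        by_cases h2 : i = c'
        · exact Or.inr (Or.inl h2)
        · refine Or.inr (Or.inr ?_)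
          rw [hS]
          simp only [coe_union, Set.mem_union, mem_coe, mem_erase]
          exact Or.inl ⟨h2, h1, hi⟩)))
      (by rw [hSC c' hc' c hc hne hS']; exact hib c' hc')
      (by rw [hSC c' hc' c hc hne hS']; exact hid c' hc')
      (by rw [hSC c hc c' hc' hne.symm rfl]; exact hib c hc)
      (by rw [hSC c hc c' hc' hne.symm rfl]; exact hid c hc)
    have lt : ∀ {i j : Fin n}, i < j → stdOrder n i < stdOrder n j := fun h => stdOrder_strictMono h
    have pos : ∀ i : Fin n, (i < c ∧ i < c' ∨ c < i ∧ c' < i) →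
        0 < (stdOrder n i - stdOrder n c) * (stdOrder n i - stdOrder n c') := by
      rintro i (⟨h1, h2⟩ | ⟨h1, h2⟩)
      · exact mul_pos_of_neg_of_neg (sub_neg.2 (lt h1)) (sub_neg.2 (lt h2))
      · exact mul_pos (sub_pos.2 (lt h1)) (sub_pos.2 (lt h2))
    have neg : ∀ i : Fin n, (i < c ∧ c' < i ∨ c < i ∧ i < c') →
        (stdOrder n i - stdOrder n c) * (stdOrder n i - stdOrder n c') < 0 := by
      rintro i (⟨h1, h2⟩ | ⟨h1, h2⟩)
      · exact mul_neg_of_neg_of_pos (sub_neg.2 (lt h1)) (sub_pos.2 (lt h2))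
      · exact mul_neg_of_pos_of_neg (sub_pos.2 (lt h1)) (sub_neg.2 (lt h2))
    rcases hsep with ⟨h1, h2⟩ | ⟨h1, h2⟩
    · exact absurd this (mul_neg_of_pos_of_neg (pos b h1) (neg d h2)).not_gt
    · exact absurd this (mul_neg_of_neg_of_pos (neg b h2) (pos d h1)).not_gt
  have hsplit : ∀ X : Finset (Fin n), (X ∩ cyclicInterval a m).card + (X ∩ gap C c).card = X.card := by
    intro X
    have h1 : X ∩ gap C c = X \ cyclicInterval a m := by
      ext e
      simp [hgap]
    rw [h1, card_inter_add_card_sdiff]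
  have hrank : ∀ J' ∈ columnMatroid B,
      (J'.1 ∩ cyclicInterval a m).card ≤ k - (T ∩ gap C c).card := by
    intro J' hJ'
    rw [mem_columnMatroid_iff_linearIndepOn] at hJ'
    have h1 := card_le_finrank_of_linearIndepOn (s := J'.1 ∩ cyclicInterval a m)
      (hJ'.mono (by simp)) (fun i hi => hsp i (mem_inter.1 hi).2)
    refine h1.trans ?_
    rw [← coe_union, ← coe_sdiff]
    refine (finrank_span_image_le_card _ _).trans ?_
    have h2 : (C.erase c ∪ T) \ gap C c ⊆ (C.erase c) ∪ (T ∩ cyclicInterval a m) := by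
      intro e
      simp only [mem_sdiff, mem_union, mem_inter, hgap]
      tauto
    refine (card_le_card h2).trans ((card_union_le _ _).trans ?_)
    have h3 := hsplit T
    rw [card_erase_of_mem hc]
    have := card_pos.2 ⟨c, hc⟩
    omega
  have h1 := hJ a m _ hrank
  have h2 := hsplit J.1
  rw [J.2] at h2
  have h3 : (T ∩ gap C c).card ≤ k := by
    have h4 := hsplit T
    have := card_pos.2 ⟨c, hc⟩
    omega
  omega

theorem IsPositroid.mem_of_cyclicInterval {M : Set (KSubset k n)} (hM : IsPositroid M)
    {J : KSubset k n} (hJ : ∀ a m r, (∀ J' ∈ M, (J'.1 ∩ cyclicInterval a m).card ≤ r) →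
      (J.1 ∩ cyclicInterval a m).card ≤ r) : J ∈ M := by
  obtain ⟨B, hr, hB, rfl⟩ := isPositroid_iff.1 hM
  exact mem_columnMatroid_of_cyclicInterval hr hB hJ

end RankConditions

/-! ### Replacing one element of a `k`-set. -/

section Exchange

variable {k n : ℕ}

/-- The set obtained from `J` by replacing `i` with the new element `i'`. -/
def exchange (J : KSubset k n) {i i' : Fin n} (hi : i ∈ J.1) (hi' : i' ∉ J.1) : KSubset k n :=
  ⟨insert i' (J.1.erase i), by
    rw [card_insert_of_notMem (fun h => hi' (mem_of_mem_erase h)), card_erase_of_mem hi, J.2]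
    have := card_pos.2 ⟨i, hi⟩
    rw [J.2] at this
    omega⟩

theorem exchange_exchange (J : KSubset k n) {i i' : Fin n} (hi : i ∈ J.1) (hi' : i' ∉ J.1)
    (h : i' ∈ (exchange J hi hi').1) (h' : i ∉ (exchange J hi hi').1) :
    exchange (exchange J hi hi') h h' = J := by
  apply Subtype.ext
  simp only [exchange]
  rw [erase_insert (by simp [hi']), insert_erase hi]

theorem card_filter_exchange (J : KSubset k n) {i i' : Fin n} (hi : i ∈ J.1) (hi' : i' ∉ J.1)
    {q : Fin n → Prop} [DecidablePred q] (hq : q i) (hq' : q i') :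
    ((exchange J hi hi').1.filter q).card = (J.1.filter q).card := by
  simp only [exchange]
  rw [filter_insert, if_pos hq', card_insert_of_notMem (by simp [hi']), filter_erase,
    card_erase_of_mem (by simp [hi, hq])]
  have := card_pos.2 ⟨i, mem_filter.2 ⟨hi, hq⟩⟩
  omega

theorem injective_update {f : Fin k → Fin n} (hf : Function.Injective f) (t : Fin k) {i : Fin n}
    (hi : i ∉ Set.range f) : Function.Injective (Function.update f t i) := by
  intro a b hab
  by_cases ha : a = t <;> by_cases hb : b = t
  · rw [ha, hb]
  · subst ha
    rw [Function.update_self, Function.update_of_ne hb] at hab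
    exact absurd ⟨b, hab.symm⟩ hi
  · subst hb
    rw [Function.update_self, Function.update_of_ne ha] at hab
    exact absurd ⟨a, hab⟩ hi
  · rw [Function.update_of_ne ha, Function.update_of_ne hb] at hab
    exact hf hab

theorem imageSubset_update {f : Fin k → Fin n} (hf : Function.Injective f) (t : Fin k) {i : Fin n}
    (hi : i ∉ Set.range f) :
    imageSubset (Function.update f t i) (injective_update hf t hi) =
      exchange (imageSubset f hf) (i := f t) (i' := i) (by simp [imageSubset])
        (by simpa [imageSubset] using hi) := by
  apply Subtype.ext
  ext e
  simp only [imageSubset, exchange, mem_image, mem_univ, true_and, mem_insert, mem_erase]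
  constructor
  · rintro ⟨s, rfl⟩
    by_cases hs : s = t
    · subst hs; simp
    · right
      rw [Function.update_of_ne hs]
      exact ⟨hf.ne hs, s, rfl⟩
  · rintro (rfl | ⟨h, s, rfl⟩)
    · exact ⟨t, by simp⟩
    · exact ⟨s, by rw [Function.update_of_ne (fun h' => h (by rw [h']))]⟩

theorem exists_strictMono_enumeration {x : Fin n → ℝ} (hx : Function.Injective x)
    (J : KSubset k n) :
    ∃ (f : Fin k → Fin n) (hf : Function.Injective f), StrictMono (x ∘ f) ∧ imageSubset f hf = J := by
  have h0 := (J.1.orderEmbOfFin J.2).injective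
  obtain ⟨σ, hσ⟩ := exists_perm_strictMono hx h0
  refine ⟨_, h0.comp σ.injective, hσ, Subtype.ext ?_⟩
  apply Finset.coe_injective
  rw [imageSubset, coe_image, coe_univ, Set.image_univ, σ.surjective.range_comp,
    range_orderEmbOfFin]

end Exchange

/-! ### Adding a column to its right neighbour. -/

section AddColumn

variable {k n : ℕ}

/-- The matrix obtained from `B` by adding column `i` to column `i'`. -/
def addCol (B : Matrix (Fin k) (Fin n) ℝ) (i i' : Fin n) : Matrix (Fin k) (Fin n) ℝ :=
  B.updateCol i' (B.col i' + B.col i)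

theorem detCols_addCol_of_notMem (B : Matrix (Fin k) (Fin n) ℝ) (i : Fin n) {i' : Fin n}
    {f : Fin k → Fin n} (hf : i' ∉ Set.range f) : detCols (addCol B i i') f = detCols B f := by
  rw [detCols, detCols]
  congr 1
  ext a b
  simp only [addCol, Matrix.submatrix_apply]
  rw [Matrix.updateCol_ne (fun h => hf ⟨b, h⟩)]

theorem detCols_addCol_of_eq (B : Matrix (Fin k) (Fin n) ℝ) (i : Fin n) {f : Fin k → Fin n}
    (hf : Function.Injective f) (t : Fin k) :
    detCols (addCol B i (f t)) f = detCols B f + detCols B (Function.update f t i) := by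
  have h1 : (addCol B i (f t)).submatrix id f =
      (B.submatrix id f).updateCol t (B.col (f t) + B.col i) := by
    ext a b
    by_cases hb : b = t
    · subst hb; simp [addCol]
    · simp [addCol, Matrix.updateCol_ne hb, Matrix.updateCol_ne (hf.ne hb)]
  have h2 : B.submatrix id (Function.update f t i) = (B.submatrix id f).updateCol t (B.col i) := by
    ext a b
    by_cases hb : b = t
    · subst hb; simp [Matrix.col]
    · simp [Matrix.updateCol_ne hb, Function.update_of_ne hb]
  rw [detCols, detCols, detCols, h1, h2, Matrix.det_updateCol_add]
  congr 2
  ext a b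
  by_cases hb : b = t
  · subst hb; simp [Matrix.col]
  · simp [Matrix.updateCol_ne hb]

variable {p : Equiv.Perm (Fin n)} {B : Matrix (Fin k) (Fin n) ℝ} {i i' : Fin n}

/-- As `i` immediately precedes `i'`, no other column can lie between them, so replacing `i'` by `i`
keeps a tuple sorted. -/
theorem strictMono_update (hii : (p i').val = (p i).val + 1) {f : Fin k → Fin n}
    (hf : StrictMono ((stdOrder n ∘ p) ∘ f)) {t : Fin k} (ht : f t = i') (hi : i ∉ Set.range f) :
    StrictMono ((stdOrder n ∘ p) ∘ Function.update f t i) := by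
  have key : ∀ {u v : Fin n}, (stdOrder n ∘ p) u < (stdOrder n ∘ p) v ↔ (p u).val < (p v).val := by
    intro u v
    rw [Function.comp, Function.comp, stdOrder_strictMono.lt_iff_lt, Fin.lt_def]
  intro a b hab
  have hab' := key.1 (hf hab)
  refine key.2 ?_
  by_cases ha : a = t <;> by_cases hb : b = t
  · omega
  · subst ha
    rw [Function.update_self, Function.update_of_ne hb]
    rw [ht] at hab'
    omega
  · subst hb
    rw [Function.update_self, Function.update_of_ne ha]
    rw [ht] at hab'
    have : (p (f a)).val ≠ (p i).val := fun h => hi ⟨a, p.injective (Fin.ext h)⟩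
    omega
  · rw [Function.update_of_ne ha, Function.update_of_ne hb]
    exact hab'

theorem stdOrder_comp_perm_injective : Function.Injective (stdOrder n ∘ p) :=
  stdOrder_strictMono.injective.comp p.injective

theorem detCols_update_nonneg (hB : IsTotallyNonneg (stdOrder n ∘ p) B)
    (hii : (p i').val = (p i).val + 1) {f : Fin k → Fin n}
    (hf : StrictMono ((stdOrder n ∘ p) ∘ f)) {t : Fin k} (ht : f t = i') :
    0 ≤ detCols B (Function.update f t i) := by
  by_cases hi : i ∈ Set.range f
  · obtain ⟨s, hs⟩ := hi
    have hst : s ≠ t := by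
      rintro rfl
      rw [ht] at hs
      subst hs
      omega
    rw [detCols_eq_zero_of_not_injective]
    intro h
    exact hst (h (by simp [Function.update_of_ne hst, hs]))
  · exact (isTotallyNonneg_iff stdOrder_comp_perm_injective).1 hB _ (strictMono_update hii hf ht hi)

/-- Each sorted minor of the new matrix is an old one or a sum of two nonnegative old ones. As
nothing cancels, no basis is lost, and every exchange of `i` for `i'` in an old basis gives a new
basis. -/
theorem IsTotallyNonneg.addCol (hB : IsTotallyNonneg (stdOrder n ∘ p) B)
    (hii : (p i').val = (p i).val + 1) : IsTotallyNonneg (stdOrder n ∘ p) (addCol B i i') := by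
  rw [isTotallyNonneg_iff stdOrder_comp_perm_injective]
  intro f hf
  have h1 := (isTotallyNonneg_iff stdOrder_comp_perm_injective).1 hB f hf
  by_cases h : i' ∈ Set.range f
  · obtain ⟨t, ht⟩ := h
    have h2 := detCols_update_nonneg hB hii hf ht
    subst ht
    rw [detCols_addCol_of_eq B i hf.injective.of_comp]
    exact add_nonneg h1 h2
  · rwa [detCols_addCol_of_notMem B i h]

theorem columnMatroid_subset_addCol (hB : IsTotallyNonneg (stdOrder n ∘ p) B)
    (hii : (p i').val = (p i).val + 1) : columnMatroid B ⊆ columnMatroid (addCol B i i') := by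
  intro J hJ
  obtain ⟨f, hf, hfm, rfl⟩ := exists_strictMono_enumeration
    (stdOrder_comp_perm_injective (p := p)) J
  rw [imageSubset_mem_columnMatroid_iff] at hJ ⊢
  have h1 := (isTotallyNonneg_iff stdOrder_comp_perm_injective).1 hB f hfm
  by_cases h : i' ∈ Set.range f
  · obtain ⟨t, ht⟩ := h
    have h2 := detCols_update_nonneg hB hii hfm ht
    subst ht
    rw [detCols_addCol_of_eq B i hf]
    exact (add_pos_of_pos_of_nonneg (lt_of_le_of_ne h1 hJ.symm) h2).ne'
  · rwa [detCols_addCol_of_notMem B i h]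

theorem exchange_mem_columnMatroid_addCol (hB : IsTotallyNonneg (stdOrder n ∘ p) B)
    (hii : (p i').val = (p i).val + 1) {J : KSubset k n} (hJ : J ∈ columnMatroid B)
    (hi : i ∈ J.1) (hi' : i' ∉ J.1) : exchange J hi hi' ∈ columnMatroid (addCol B i i') := by
  obtain ⟨f, hf, hfm, hfJ⟩ := exists_strictMono_enumeration
    (stdOrder_comp_perm_injective (p := p)) (exchange J hi hi')
  obtain ⟨t, rfl⟩ : ∃ t, f t = i' := by
    have : i' ∈ (imageSubset f hf).1 := by rw [hfJ]; simp [exchange]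
    simpa [imageSubset] using this
  have hne : i ≠ f t := fun h => hi' (h ▸ hi)
  have hi2 : i ∉ (exchange J hi hi').1 := by simp [exchange, hne]
  have hif : i ∉ Set.range f := by
    rw [← hfJ] at hi2
    simpa [imageSubset] using hi2
  rw [← hfJ, imageSubset_mem_columnMatroid_iff, detCols_addCol_of_eq B i hf]
  have h1 := (isTotallyNonneg_iff stdOrder_comp_perm_injective).1 hB f hfm
  have h2 := detCols_update_nonneg hB hii hfm rfl
  have h3 : detCols B (Function.update f t i) ≠ 0 := by
    rw [← imageSubset_mem_columnMatroid_iff B (injective_update hf t hif),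
      imageSubset_update hf t hif]
    have h4 : f t ∈ (exchange J hi hi').1 := by simp [exchange]
    have h5 := exchange_exchange J hi hi' h4 hi2
    simp only [hfJ]
    rwa [h5]
  exact (add_pos_of_nonneg_of_pos h1 (lt_of_le_of_ne h2 h3.symm)).ne'

theorem mem_or_exchange_mem_of_mem_addCol {J : KSubset k n}
    (hJ : J ∈ columnMatroid (addCol B i i')) (hne : i ≠ i') :
    J ∈ columnMatroid B ∨
      ∃ (hi' : i' ∈ J.1) (hi : i ∉ J.1), exchange J hi' hi ∈ columnMatroid B := by
  by_contra hcon
  push Not at hcon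
  obtain ⟨h1, h2⟩ := hcon
  obtain ⟨f, hf, -, rfl⟩ := exists_strictMono_enumeration stdOrder_strictMono.injective J
  rw [imageSubset_mem_columnMatroid_iff] at hJ
  rw [imageSubset_mem_columnMatroid_iff, not_not] at h1
  by_cases h : i' ∈ Set.range f
  · obtain ⟨t, rfl⟩ := h
    rw [detCols_addCol_of_eq B i hf, h1, zero_add] at hJ
    have hif : i ∉ Set.range f := by
      rintro ⟨s, rfl⟩
      apply hJ
      apply detCols_eq_zero_of_not_injective
      intro h
      have hst : s ≠ t := fun h => hne (by rw [h])
      exact hst (h (by simp [Function.update_of_ne hst]))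
    refine h2 (by simp [imageSubset]) (by simpa [imageSubset] using hif) ?_
    rw [← imageSubset_update hf t hif, imageSubset_mem_columnMatroid_iff]
    exact hJ
  · rw [detCols_addCol_of_notMem B i h] at hJ
    exact hJ h1

end AddColumn

/-! ### Realizing a single interval rank condition. -/

section Interval

variable {k n : ℕ}

theorem exists_isTotallyNonneg_initial (p : Equiv.Perm (Fin n)) (m r : ℕ) :
    ∃ B : Matrix (Fin k) (Fin n) ℝ, IsTotallyNonneg (stdOrder n ∘ p) B ∧
      columnMatroid B = {J | ∀ j ∈ J.1, (p j).val < m → (p j).val < r} := by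
  -- A Vandermonde matrix with the columns in positions `r, …, m - 1` set to zero: at most `r`
  -- nonzero columns remain in the initial segment of length `m`, and all others are generic.
  set B : Matrix (Fin k) (Fin n) ℝ := Matrix.of fun i j =>
    if (p j).val < m → (p j).val < r then (stdOrder n (p j)) ^ (i : ℕ) else 0 with hB
  have hgood : ∀ f : Fin k → Fin n, (∀ t, (p (f t)).val < m → (p (f t)).val < r) →
      detCols B f = (Matrix.vandermonde ((stdOrder n ∘ p) ∘ f)).det := by
    intro f hf
    rw [detCols, ← Matrix.det_transpose]
    congr 1
    ext i j
    simp only [hB, Matrix.transpose_apply, Matrix.submatrix_apply, Matrix.of_apply, id,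
      if_pos (hf i), Matrix.vandermonde_apply, Function.comp]
  have hbad : ∀ f : Fin k → Fin n, ¬ (∀ t, (p (f t)).val < m → (p (f t)).val < r) →
      detCols B f = 0 := by
    intro f hf
    rw [not_forall] at hf
    obtain ⟨t, ht⟩ := hf
    refine Matrix.det_eq_zero_of_column_eq_zero t fun i => ?_
    simp only [hB, Matrix.submatrix_apply, Matrix.of_apply, if_neg ht]
  refine ⟨B, ?_, ?_⟩
  · rw [isTotallyNonneg_iff stdOrder_comp_perm_injective]
    intro f hf
    by_cases h : ∀ t, (p (f t)).val < m → (p (f t)).val < r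
    · rw [hgood f h]
      exact (det_vandermonde_pos hf).le
    · rw [hbad f h]
  · ext J
    obtain ⟨f, hf, hfm, rfl⟩ := exists_strictMono_enumeration
      (stdOrder_comp_perm_injective (p := p)) J
    rw [imageSubset_mem_columnMatroid_iff]
    have h1 : imageSubset f hf ∈ {J : KSubset k n | ∀ j ∈ J.1, (p j).val < m → (p j).val < r} ↔
        ∀ t, (p (f t)).val < m → (p (f t)).val < r := by
      simp [imageSubset]
    rw [h1]
    by_cases h : ∀ t, (p (f t)).val < m → (p (f t)).val < r
    · rw [hgood f h]
      exact ⟨fun _ => h, fun _ => (det_vandermonde_pos hfm).ne'⟩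
    · rw [hbad f h]
      simp [h]

/-- Otherwise `J` would contain every position from `0` up to that of `j`, which is more than `r`
elements of the segment. -/
theorem exists_pred_notMem {p : Equiv.Perm (Fin n)} {m r : ℕ} {J : Finset (Fin n)}
    (hJ : (J.filter fun j => (p j).val < m).card ≤ r) {j : Fin n} (hj : j ∈ J)
    (hjm : (p j).val < m) (hjr : r ≤ (p j).val) :
    ∃ i ∉ J, ∃ i' ∈ J, (p i').val = (p i).val + 1 ∧ (p i').val < m := by
  by_contra hcon
  push Not at hcon
  have key : ∀ t (ht : t ≤ (p j).val), p.symm ⟨t, ht.trans_lt (p j).2⟩ ∈ J := by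
    intro t ht
    induction ht using Nat.decreasingInduction with
    | self => simpa using hj
    | of_succ t ht ih =>
      by_contra h
      have := hcon _ h _ ih (by simp)
      simp only [Equiv.apply_symm_apply] at this
      omega
  have h1 : (univ.image fun t : Fin ((p j).val + 1) =>
      p.symm ⟨t.val, (Nat.lt_succ_iff.1 t.2).trans_lt (p j).2⟩) ⊆
      J.filter fun j => (p j).val < m := by
    intro e he
    obtain ⟨t, -, rfl⟩ := mem_image.1 he
    refine mem_filter.2 ⟨key _ (Nat.lt_succ_iff.1 t.2), ?_⟩
    simp only [Equiv.apply_symm_apply]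
    omega
  have h2 := card_le_card h1
  rw [card_image_of_injective _ (by
    intro a b hab
    have := p.symm.injective hab
    simpa [Fin.ext_iff] using this)] at h2
  simp at h2
  omega

/-- Among the realizable matroids between the initial one and the target, a maximal one is stable
under column addition, hence closed under moving an element one place to the right inside the
segment. Every target set arises by such moves from a set that avoids positions `r, …, m - 1`. -/
theorem exists_isTotallyNonneg_columnMatroid_eq (p : Equiv.Perm (Fin n)) (m r : ℕ) :
    ∃ B : Matrix (Fin k) (Fin n) ℝ, IsTotallyNonneg (stdOrder n ∘ p) B ∧
      columnMatroid B = {J | (J.1.filter fun j => (p j).val < m).card ≤ r} := by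
  set 𝒮 : Set (Set (KSubset k n)) := {N | {J | ∀ j ∈ J.1, (p j).val < m → (p j).val < r} ⊆ N ∧
    N ⊆ {J | (J.1.filter fun j => (p j).val < m).card ≤ r} ∧
    ∃ B : Matrix (Fin k) (Fin n) ℝ, IsTotallyNonneg (stdOrder n ∘ p) B ∧ columnMatroid B = N}
    with h𝒮
  have hne : {J : KSubset k n | ∀ j ∈ J.1, (p j).val < m → (p j).val < r} ∈ 𝒮 := by
    refine ⟨subset_rfl, fun J hJ => ?_, exists_isTotallyNonneg_initial p m r⟩
    have h1 : ((J.1.filter fun j => (p j).val < m).image fun j => (p j).val) ⊆ range r := by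
      intro e he
      obtain ⟨j, hj, rfl⟩ := mem_image.1 he
      exact mem_range.2 (hJ j (mem_filter.1 hj).1 (mem_filter.1 hj).2)
    have h2 := card_le_card h1
    rwa [card_image_of_injective _ (f := fun j => (p j).val) (Fin.val_injective.comp p.injective),
      card_range] at h2
  obtain ⟨N, -, ⟨hN0, hNU, B, hB, rfl⟩, hmax⟩ := (Set.toFinite 𝒮).exists_le_maximal hne
  have hclosed : ∀ {i i' : Fin n}, (p i').val = (p i).val + 1 → (p i').val < m →
      ∀ {J : KSubset k n} (hi : i ∈ J.1) (hi' : i' ∉ J.1), J ∈ columnMatroid B →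
        exchange J hi hi' ∈ columnMatroid B := by
    intro i i' hii him J hi hi' hJ
    have hne : i ≠ i' := by rintro rfl; omega
    refine hmax ⟨hN0.trans (columnMatroid_subset_addCol hB hii), ?_, addCol B i i',
      hB.addCol hii, rfl⟩ (columnMatroid_subset_addCol hB hii)
      (exchange_mem_columnMatroid_addCol hB hii hJ hi hi')
    intro J' hJ'
    rcases mem_or_exchange_mem_of_mem_addCol hJ' hne with h | ⟨hi', hi, h⟩
    · exact hNU h
    · have := hNU h
      rw [Set.mem_ofPred_eq, card_filter_exchange J' hi' hi him (by omega)] at this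
      exact this
  refine ⟨B, hB, hNU.antisymm fun J hJ => ?_⟩
  -- Moving an element one place left lowers the sum of positions and preserves the count in the
  -- segment; `hclosed` undoes the move.
  induction hs : ∑ j ∈ J.1, (p j).val using Nat.strong_induction_on generalizing J with
  | _ s ih =>
    by_cases h0 : ∀ j ∈ J.1, (p j).val < m → (p j).val < r
    · exact hN0 h0
    push Not at h0
    obtain ⟨j, hj, hjm, hjr⟩ := h0
    obtain ⟨i, hi, i', hi', hii, him⟩ := exists_pred_notMem hJ hj hjm hjr
    have hne : i ≠ i' := by rintro rfl; omega
    have hmem : exchange J hi' hi ∈ columnMatroid B := by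
      refine ih (∑ j ∈ (exchange J hi' hi).1, (p j).val) ?_ _ ?_ rfl
      · simp only [exchange]
        rw [sum_insert (by simp [hi]), ← hs, ← add_sum_erase _ _ hi']
        omega
      · rw [Set.mem_ofPred_eq, card_filter_exchange J hi' hi him (by omega)]
        exact hJ
    have h1 : i ∈ (exchange J hi' hi).1 := by simp [exchange]
    have h2 : i' ∉ (exchange J hi' hi).1 := by simp [exchange, hne.symm]
    have h3 := hclosed hii him h1 h2 hmem
    rwa [exchange_exchange J hi' hi h1 h2] at h3

/-! ### Cyclic rotation -/

theorem detCols_mul_row (B : Matrix (Fin k) (Fin n) ℝ) (w : Fin n → ℝ) (f : Fin k → Fin n) :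
    detCols (Matrix.of fun i j => w j * B i j) f = (∏ i, w (f i)) * detCols B f := by
  rw [detCols, detCols, ← Matrix.det_mul_row]
  rfl

/-- Factoring out row scalars turns `(c - y)⁻¹` into the homogeneous pair `(1, c - y)`, and the
differences of `c - y` are those of `y` with the roles swapped. This replaces the usual sign
`(-1)^(k-1)` attached to cyclic rotation. -/
theorem det_vandermonde_moebius (c : ℝ) (y : Fin k → ℝ) (hy : ∀ i, c - y i ≠ 0) :
    (Matrix.vandermonde y).det =
      (∏ i, (c - y i) ^ (k - 1)) * (Matrix.vandermonde fun i => (c - y i)⁻¹).det := by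
  have h1 : (Matrix.vandermonde y).det =
      (Matrix.projVandermonde (fun _ => 1) (fun i => c - y i)).det := by
    rw [Matrix.det_vandermonde, Matrix.det_projVandermonde]
    refine prod_congr rfl fun i _ => prod_congr rfl fun j _ => ?_
    ring
  rw [h1, ← Matrix.det_mul_column]
  congr 1
  ext i j
  rw [Matrix.projVandermonde_apply, Matrix.of_apply, Matrix.vandermonde_apply, one_pow, one_mul,
    inv_pow, ← div_eq_mul_inv, eq_div_iff (pow_ne_zero _ (hy i)), ← pow_add]
  congr 1
  rw [Fin.val_rev]
  omega

/-- The real numbers `1 / (a - 1/2 - j)` are ordered like the cyclic order starting at `a`. -/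
theorem moebius_lt_iff (a i j : Fin n) :
    ((a : ℕ) - 1 / 2 - stdOrder n i : ℝ)⁻¹ < ((a : ℕ) - 1 / 2 - stdOrder n j : ℝ)⁻¹ ↔
      (i - a).val < (j - a).val := by
  have hneg : ∀ i : Fin n, a ≤ i → ((a : ℕ) - 1 / 2 - stdOrder n i : ℝ) < 0 := by
    intro i h
    have : ((a : ℕ) : ℝ) ≤ (i : ℕ) := by exact_mod_cast h
    simp only [stdOrder]
    linarith
  have hpos : ∀ i : Fin n, i < a → 0 < ((a : ℕ) - 1 / 2 - stdOrder n i : ℝ) := by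
    intro i h
    have h : i.val + 1 ≤ a.val := h
    have : ((i : ℕ) : ℝ) + 1 ≤ (a : ℕ) := by exact_mod_cast h
    simp only [stdOrder]
    linarith
  have hi := val_sub_cases i a
  have hj := val_sub_cases j a
  rcases lt_or_ge i a with h1 | h1 <;> rcases lt_or_ge j a with h2 | h2
  · rw [inv_lt_inv₀ (hpos i h1) (hpos j h2), sub_lt_sub_iff_left, stdOrder_strictMono.lt_iff_lt]
    simp only [Fin.lt_def] at *
    omega
  · refine iff_of_false (not_lt.2 ?_) ?_
    · exact (inv_lt_zero.2 (hneg j h2)).le.trans (inv_pos.2 (hpos i h1)).le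
    · simp only [Fin.lt_def, Fin.le_def] at h1 h2
      omega
  · refine iff_of_true ?_ ?_
    · exact (inv_lt_zero.2 (hneg i h1)).trans (inv_pos.2 (hpos j h2))
    · simp only [Fin.lt_def, Fin.le_def] at h1 h2
      omega
  · rw [inv_lt_inv_of_neg (hneg i h1) (hneg j h2), sub_lt_sub_iff_left,
      stdOrder_strictMono.lt_iff_lt]
    simp only [Fin.lt_def, Fin.le_def] at *
    omega

theorem columnMatroid_mul_row (B : Matrix (Fin k) (Fin n) ℝ) {w : Fin n → ℝ} (hw : ∀ j, w j ≠ 0) :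
    columnMatroid (Matrix.of fun i j => w j * B i j) = columnMatroid B := by
  ext J
  obtain ⟨f, hf, -, rfl⟩ := exists_strictMono_enumeration stdOrder_strictMono.injective J
  rw [imageSubset_mem_columnMatroid_iff, imageSubset_mem_columnMatroid_iff, detCols_mul_row]
  simp [prod_ne_zero_iff, hw]

/-- The sets satisfying one rank condition on a cyclic interval form a positroid. -/
theorem isPositroid_cyclicInterval (a : Fin n) (m r : ℕ)
    (hne : ∃ J : KSubset k n, (J.1 ∩ cyclicInterval a m).card ≤ r) :
    IsPositroid {J : KSubset k n | (J.1 ∩ cyclicInterval a m).card ≤ r} := by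
  have : NeZero n := ⟨by rintro rfl; exact a.elim0⟩
  have hinter : ∀ J : Finset (Fin n), J ∩ cyclicInterval a m =
      J.filter fun j => (Equiv.subRight a j).val < m := by
    intro J
    ext e
    simp
  simp only [hinter] at hne ⊢
  obtain ⟨B, hB, hBM⟩ := exists_isTotallyNonneg_columnMatroid_eq (k := k) (Equiv.subRight a) m r
  -- The pole is placed between `a - 1` and `a`, so that `1 / (c - x)` reads the integer points in
  -- cyclic order from `a`.
  set c : ℝ := (a : ℕ) - 1 / 2 with hc
  have hc0 : ∀ j : Fin n, c - stdOrder n j ≠ 0 := by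
    intro j h
    have h1 : (2 * (a : ℕ) : ℝ) = 2 * (j : ℕ) + 1 := by
      simp only [hc, stdOrder] at h
      linarith
    have h2 : 2 * a.val = 2 * j.val + 1 := by exact_mod_cast h1
    omega
  set z : Fin n → ℝ := fun j => (c - stdOrder n j)⁻¹ with hz
  have hzlt : ∀ i j, z i < z j ↔
      (stdOrder n ∘ Equiv.subRight a) i < (stdOrder n ∘ Equiv.subRight a) j := by
    intro i j
    rw [hz, hc]
    simp only
    rw [moebius_lt_iff, Function.comp, Function.comp, stdOrder_strictMono.lt_iff_lt, Fin.lt_def]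
    rfl
  have hzinj : Function.Injective z := by
    intro i j hij
    have := inv_injective hij
    exact stdOrder_strictMono.injective (by linarith)
  have hBz : IsTotallyNonneg z B := by
    rw [isTotallyNonneg_iff hzinj]
    intro f hf
    exact (isTotallyNonneg_iff stdOrder_comp_perm_injective).1 hB f
      fun i j hij => (hzlt _ _).1 (hf hij)
  rw [isPositroid_iff]
  have hw : ∀ j, (c - stdOrder n j) ^ (k - 1) ≠ 0 := fun j => pow_ne_zero _ (hc0 j)
  -- With this column scaling, the scalars from the minor and from the Vandermonde determinant
  -- multiply to a square.
  refine ⟨Matrix.of fun i j => (c - stdOrder n j) ^ (k - 1) * B i j, ?_, ?_, ?_⟩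
  · obtain ⟨J, hJ⟩ := hne
    refine rank_eq_of_mem_columnMatroid (J := J) ?_
    rw [columnMatroid_mul_row B hw, hBM]
    exact hJ
  · intro f
    rw [detCols_mul_row, det_vandermonde_moebius c (stdOrder n ∘ f) (fun i => hc0 (f i))]
    have h1 := hBz f
    have h2 : ∏ i, (c - (stdOrder n ∘ f) i) ^ (k - 1) = ∏ i, (c - stdOrder n (f i)) ^ (k - 1) := rfl
    rw [h2, mul_mul_mul_comm]
    exact mul_nonneg (mul_self_nonneg _) h1
  · rw [columnMatroid_mul_row B hw, hBM]

end Interval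

/-! ### Greedy bases -/

section Greedy

variable {ι K V : Type*} [Fintype ι] [Field K] [AddCommGroup V] [Module K V]

open Classical in
/-- The lexicographically minimal basis of a vector configuration, for the order given by `q`. -/
def greedyBasis (K : Type*) {ι V : Type*} [Fintype ι] [Field K] [AddCommGroup V] [Module K V]
    (q : ι → ℕ) (v : ι → V) : Finset ι :=
  univ.filter fun b => v b ∉ Submodule.span K (v '' {e | q e < q b})

variable {q : ι → ℕ} {v : ι → V}

theorem mem_greedyBasis {b : ι} :
    b ∈ greedyBasis K q v ↔ v b ∉ Submodule.span K (v '' {e | q e < q b}) := by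
  simp [greedyBasis]

theorem mem_span_greedyBasis_le (e : ι) :
    v e ∈ Submodule.span K (v '' {b | b ∈ greedyBasis K q v ∧ q b ≤ q e}) := by
  induction hs : q e using Nat.strong_induction_on generalizing e with
  | _ s ih =>
    subst hs
    by_cases he : e ∈ greedyBasis K q v
    · exact Submodule.subset_span ⟨e, ⟨he, le_rfl⟩, rfl⟩
    · rw [mem_greedyBasis, not_not] at he
      refine Submodule.span_le.2 ?_ he
      rintro _ ⟨e', he', rfl⟩
      refine Submodule.span_mono (Set.image_mono ?_) (ih _ he' e' rfl)
      exact fun b hb => ⟨hb.1, hb.2.trans (le_of_lt he')⟩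

theorem span_greedyBasis_lt (q : ι → ℕ) (v : ι → V) (t : ℕ) :
    Submodule.span K (v '' {b | b ∈ greedyBasis K q v ∧ q b < t}) =
      Submodule.span K (v '' {e | q e < t}) := by
  apply le_antisymm
  · exact Submodule.span_mono (Set.image_mono fun b hb => hb.2)
  · rw [Submodule.span_le]
    rintro _ ⟨e, he, rfl⟩
    refine Submodule.span_mono (Set.image_mono ?_) (mem_span_greedyBasis_le (q := q) e)
    exact fun b hb => ⟨hb.1, lt_of_le_of_lt hb.2 he⟩

theorem linearIndepOn_greedyBasis (hq : Function.Injective q) :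
    LinearIndepOn K v (greedyBasis K q v : Set ι) := by
  have key : ∀ t, LinearIndepOn K v {b | b ∈ greedyBasis K q v ∧ q b < t} := by
    intro t
    induction t with
    | zero => simp
    | succ t ih =>
      by_cases h : ∃ b ∈ greedyBasis K q v, q b = t
      · obtain ⟨b, hb, rfl⟩ := h
        have h1 : {e | e ∈ greedyBasis K q v ∧ q e < q b + 1} =
            insert b {e | e ∈ greedyBasis K q v ∧ q e < q b} := by
          ext e
          simp only [Set.mem_ofPred_eq, Set.mem_insert_iff, Nat.lt_succ_iff_lt_or_eq]
          constructor
          · rintro ⟨h1, h2 | h2⟩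
            · exact Or.inr ⟨h1, h2⟩
            · exact Or.inl (hq h2)
          · rintro (rfl | h)
            · exact ⟨hb, Or.inr rfl⟩
            · exact ⟨h.1, Or.inl h.2⟩
        rw [h1, linearIndepOn_insert (by simp), span_greedyBasis_lt]
        exact ⟨ih, mem_greedyBasis.1 hb⟩
      · refine ih.mono fun e he => ⟨he.1, ?_⟩
        have : q e ≠ t := fun h' => h ⟨e, he.1, h'⟩
        have := he.2
        omega
  refine (key (univ.sup q + 1)).mono fun e he => ⟨he, Nat.lt_succ_iff.2 (le_sup (mem_univ e))⟩

theorem span_greedyBasis (q : ι → ℕ) (v : ι → V) :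
    Submodule.span K (v '' (greedyBasis K q v : Set ι)) = Submodule.span K (Set.range v) := by
  apply le_antisymm
  · exact Submodule.span_mono (Set.image_subset_range _ _)
  · rw [Submodule.span_le]
    rintro _ ⟨e, rfl⟩
    exact Submodule.span_mono (Set.image_mono fun b hb => hb.1) (mem_span_greedyBasis_le (q := q) e)

theorem finrank_span_lt_eq_card (hq : Function.Injective q) (t : ℕ) :
    Module.finrank K (Submodule.span K (v '' {e | q e < t})) =
      ((greedyBasis K q v).filter fun b => q b < t).card := by
  rw [← span_greedyBasis_lt, ← finrank_span_image_of_linearIndepOn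
    ((linearIndepOn_greedyBasis (v := v) hq).mono (coe_subset.2 (filter_subset _ _))), coe_filter]

/-- The greedy basis meets every initial segment in as many elements as the rank of that segment,
the maximum for an independent set. This extremality identifies it with the minimal basis. -/
theorem card_filter_le_card_greedyBasis [FiniteDimensional K V] (hq : Function.Injective q)
    {J : Finset ι} (hJ : LinearIndepOn K v (J : Set ι)) (t : ℕ) :
    (J.filter fun b => q b < t).card ≤ ((greedyBasis K q v).filter fun b => q b < t).card := by
  rw [← finrank_span_lt_eq_card hq]
  refine card_le_finrank_of_linearIndepOn (hJ.mono (coe_subset.2 (filter_subset _ _)))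
    fun i hi => ?_
  exact Submodule.subset_span ⟨i, (mem_filter.1 hi).2, rfl⟩

theorem mem_greedyBasis_iff_finrank_lt (hq : Function.Injective q) {b : ι} :
    b ∈ greedyBasis K q v ↔ Module.finrank K (Submodule.span K (v '' {e | q e < q b})) <
      Module.finrank K (Submodule.span K (v '' {e | q e < q b + 1})) := by
  rw [finrank_span_lt_eq_card hq, finrank_span_lt_eq_card hq]
  constructor
  · intro hb
    refine card_lt_card ?_
    rw [Finset.ssubset_iff_of_subset]
    · exact ⟨b, by simp [hb], by simp⟩
    · intro e he
      rw [mem_filter] at he ⊢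
      exact ⟨he.1, by omega⟩
  · intro h
    by_contra hb
    refine absurd (card_le_card ?_) (not_le.2 h)
    intro e he
    rw [mem_filter] at he ⊢
    refine ⟨he.1, lt_of_le_of_ne (Nat.lt_succ_iff.1 he.2) fun h' => hb ?_⟩
    rw [← hq h']
    exact he.1

/-- An element is greedy exactly when the rank jumps at its position. -/
theorem greedyBasis_congr {W : Type*} [AddCommGroup W] [Module K W] (hq : Function.Injective q)
    {w : ι → W} (h : ∀ t, Module.finrank K (Submodule.span K (v '' {e | q e < t})) =
      Module.finrank K (Submodule.span K (w '' {e | q e < t}))) :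
    greedyBasis K q v = greedyBasis K q w := by
  ext b
  rw [mem_greedyBasis_iff_finrank_lt hq, mem_greedyBasis_iff_finrank_lt hq, h, h]

end Greedy

/-! ### The two cyclic orders -/

section Positions

variable {n : ℕ}

/-- The position of `b` in the cyclic order `a, a + 1, …`. -/
def fwdPos (a b : Fin n) : ℕ := (b - a).val

/-- The position of `b` in the cyclic order `a, a - 1, …`. -/
def bwdPos (a b : Fin n) : ℕ := (a - b).val

theorem fwdPos_injective (a : Fin n) : Function.Injective (fwdPos a) := by
  intro b c h
  simp only [fwdPos] at h
  have := val_sub_cases b a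
  have := val_sub_cases c a
  ext
  omega

theorem bwdPos_injective (a : Fin n) : Function.Injective (bwdPos a) :=
  fun _ _ h => sub_val_injective_left a h

/-- A cyclic interval is an initial segment for either direction: read backwards, it starts at its
last point `a + m - 1`. Thus interval ranks control both families of greedy bases. -/
theorem exists_bwdPos_lt_iff (a : Fin n) (m : ℕ) :
    ∃ c m', ∀ e, bwdPos c e < m' ↔ fwdPos a e < m := by
  rcases Nat.eq_zero_or_pos m with rfl | hm
  · exact ⟨a, 0, by simp⟩
  rcases le_or_gt n m with hmn | hmn
  · exact ⟨a, n, fun e => iff_of_true (a - e).2 ((e - a).2.trans_le hmn)⟩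
  have hc : ∃ c : Fin n, (c.val = a.val + m - 1) ∨ (n + c.val = a.val + m - 1) := by
    by_cases h : a.val + m - 1 < n
    · exact ⟨⟨_, h⟩, Or.inl rfl⟩
    · exact ⟨⟨a.val + m - 1 - n, by omega⟩, Or.inr (by simp; omega)⟩
  obtain ⟨c, hc⟩ := hc
  refine ⟨c, m, fun e => ?_⟩
  simp only [bwdPos, fwdPos]
  have := val_sub_cases c e
  have := val_sub_cases e a
  omega

theorem exists_fwdPos_lt_iff (a : Fin n) (m : ℕ) :
    ∃ c m', ∀ e, fwdPos c e < m' ↔ bwdPos a e < m := by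
  rcases Nat.eq_zero_or_pos m with rfl | hm
  · exact ⟨a, 0, by simp⟩
  rcases le_or_gt n m with hmn | hmn
  · exact ⟨a, n, fun e => iff_of_true (e - a).2 ((a - e).2.trans_le hmn)⟩
  have hc : ∃ c : Fin n, (c.val + m - 1 = a.val) ∨ (c.val + m - 1 = n + a.val) := by
    by_cases h : m - 1 ≤ a.val
    · exact ⟨⟨a.val - (m - 1), by omega⟩, Or.inl (by simp; omega)⟩
    · exact ⟨⟨n + a.val - (m - 1), by omega⟩, Or.inr (by simp; omega)⟩
  obtain ⟨c, hc⟩ := hc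
  refine ⟨c, m, fun e => ?_⟩
  simp only [bwdPos, fwdPos]
  have := val_sub_cases a e
  have := val_sub_cases e c
  omega

end Positions

/-! ### Positroid envelopes -/

section Envelope

variable {K : Type*} [Field K] {k n : ℕ}

theorem card_greedyBasis {A : Matrix (Fin k) (Fin n) K} (hA : A.rank = k) {q : Fin n → ℕ}
    (hq : Function.Injective q) : (greedyBasis K q A.col).card = k := by
  rw [← finrank_span_image_of_linearIndepOn (linearIndepOn_greedyBasis (v := A.col) hq),
    span_greedyBasis, (span_range_col_eq_top_iff A).2 hA]
  simp

/-- The greedy basis of the columns of a matrix of full rank. -/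
def greedySubset (A : Matrix (Fin k) (Fin n) K) (hA : A.rank = k) (q : Fin n → ℕ)
    (hq : Function.Injective q) : KSubset k n :=
  ⟨greedyBasis K q A.col, card_greedyBasis hA hq⟩

theorem greedySubset_mem_columnMatroid (A : Matrix (Fin k) (Fin n) K) (hA : A.rank = k)
    (q : Fin n → ℕ) (hq : Function.Injective q) : greedySubset A hA q hq ∈ columnMatroid A := by
  rw [mem_columnMatroid_iff_linearIndepOn]
  exact linearIndepOn_greedyBasis hq

/-- The rank of the columns of `A` indexed by a cyclic interval. -/
def intervalRank (A : Matrix (Fin k) (Fin n) K) (a : Fin n) (m : ℕ) : ℕ :=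
  Module.finrank K (Submodule.span K (A.col '' {e | fwdPos a e < m}))

theorem intervalRank_le_iff {A : Matrix (Fin k) (Fin n) K} (hA : A.rank = k) (a : Fin n)
    (m r : ℕ) : intervalRank A a m ≤ r ↔
      ∀ J ∈ columnMatroid A, (J.1 ∩ cyclicInterval a m).card ≤ r := by
  have hf : ∀ J : Finset (Fin n), J ∩ cyclicInterval a m = J.filter fun b => fwdPos a b < m := by
    intro J
    ext e
    rw [mem_inter, mem_filter, mem_cyclicInterval, fwdPos]
  constructor
  · intro h J hJ
    rw [mem_columnMatroid_iff_linearIndepOn] at hJ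
    rw [hf]
    refine (card_filter_le_card_greedyBasis (fwdPos_injective a) hJ m).trans ?_
    rwa [← finrank_span_lt_eq_card (fwdPos_injective a)]
  · intro h
    have := h _ (greedySubset_mem_columnMatroid A hA _ (fwdPos_injective a))
    rw [hf] at this
    rwa [intervalRank, finrank_span_lt_eq_card (fwdPos_injective a)]

theorem columnMatroid_nonempty {A : Matrix (Fin k) (Fin n) K} (hA : A.rank = k) :
    (columnMatroid A).Nonempty :=
  ⟨_, greedySubset_mem_columnMatroid A hA Fin.val Fin.val_injective⟩

/-- The positroid envelope of `N` is the positroid with the same ranks of cyclic intervals. -/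
theorem isLeast_positroid_iff {N M : Set (KSubset k n)} (hN : N.Nonempty) :
    IsLeast {P : Set (KSubset k n) | IsPositroid P ∧ N ⊆ P} M ↔
      IsPositroid M ∧ ∀ a m r, (∀ J ∈ N, (J.1 ∩ cyclicInterval a m).card ≤ r) ↔
        ∀ J ∈ M, (J.1 ∩ cyclicInterval a m).card ≤ r := by
  constructor
  · rintro ⟨⟨hM, hNM⟩, hleast⟩
    refine ⟨hM, fun a m r => ⟨fun h => ?_, fun h J hJ => h J (hNM hJ)⟩⟩
    obtain ⟨J, hJ⟩ := hN
    -- The rank condition itself defines a positroid containing `N`, so the least one satisfies it.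
    exact hleast ⟨isPositroid_cyclicInterval a m r ⟨J, h J hJ⟩, h⟩
  · rintro ⟨hM, h⟩
    refine ⟨⟨hM, fun J hJ => hM.mem_of_cyclicInterval fun a m r hr => (h a m r).2 hr J hJ⟩, ?_⟩
    rintro P ⟨hP, hNP⟩ J hJ
    exact hP.mem_of_cyclicInterval fun a m r hr =>
      (h a m r).1 (fun J' hJ' => hr J' (hNP hJ')) J hJ

theorem mem_matVariety_iff {A : Matrix (Fin k) (Fin n) ℂ} {M : Set (KSubset k n)} :
    A ∈ matVariety M ↔ A.rank = k ∧ IsPositroid M ∧ ∀ a m r, intervalRank A a m ≤ r ↔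
      ∀ J ∈ M, (J.1 ∩ cyclicInterval a m).card ≤ r := by
  rw [matVariety, Set.mem_ofPred_eq]
  refine and_congr_right fun hA => ?_
  rw [isLeast_positroid_iff (columnMatroid_nonempty hA)]
  simp only [intervalRank_le_iff hA]

theorem intervalRank_eq_of_mem_matVariety {A A' : Matrix (Fin k) (Fin n) ℂ}
    {M : Set (KSubset k n)} (hA : A ∈ matVariety M) (hA' : A' ∈ matVariety M) (a : Fin n) (m : ℕ) :
    intervalRank A a m = intervalRank A' a m := by
  rw [mem_matVariety_iff] at hA hA'
  have h := fun r => (hA.2.2 a m r).trans (hA'.2.2 a m r).symm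
  exact le_antisymm ((h _).2 le_rfl) ((h _).1 le_rfl)

theorem mem_matVariety_of_intervalRank_eq {A A' : Matrix (Fin k) (Fin n) ℂ}
    {M : Set (KSubset k n)} (hA : A ∈ matVariety M) (hA' : A'.rank = k)
    (h : ∀ a m, intervalRank A' a m = intervalRank A a m) : A' ∈ matVariety M := by
  rw [mem_matVariety_iff] at hA ⊢
  exact ⟨hA', hA.2.1, fun a m r => by rw [h]; exact hA.2.2 a m r⟩

end Envelope

/-! ### Minimal and maximal bases -/

section CyclicLE

variable {k n : ℕ}

theorem orderEmbOfFin_le_of_card_filter_le {X Y : Finset (Fin n)} (hX : X.card = k)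
    (hY : Y.card = k)
    (h : ∀ t : Fin n, (Y.filter (· < t)).card ≤ (X.filter (· < t)).card) (i : Fin k) :
    X.orderEmbOfFin hX i ≤ Y.orderEmbOfFin hY i := by
  by_contra hlt
  rw [not_le] at hlt
  have h1 : X.filter (· < X.orderEmbOfFin hX i) ⊆
      (Finset.Iio i).map (X.orderEmbOfFin hX).toEmbedding := by
    intro e he
    rw [mem_filter] at he
    obtain ⟨j, rfl⟩ : e ∈ Set.range (X.orderEmbOfFin hX) := by simpa using he.1
    simpa using he.2
  have h2 : (Finset.Iic i).map (Y.orderEmbOfFin hY).toEmbedding ⊆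
      Y.filter (· < X.orderEmbOfFin hX i) := by
    intro e he
    obtain ⟨j, hj, rfl⟩ := mem_map.1 he
    rw [mem_filter]
    refine ⟨orderEmbOfFin_mem Y hY j, lt_of_le_of_lt ?_ hlt⟩
    simpa using hj
  have h3 := card_le_card h1
  have h4 := card_le_card h2
  rw [card_map] at h3 h4
  have h5 := h (X.orderEmbOfFin hX i)
  simp at h3 h4
  omega

theorem card_filter_positions (a : Fin n) (J : KSubset k n) (t : Fin n) :
    ((positions a J).1.filter (· < t)).card = (J.1.filter fun b => fwdPos a b < t.val).card := by
  have : NeZero n := ⟨by rintro rfl; exact a.elim0⟩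
  simp only [positions]
  rw [filter_image, card_image_of_injective _ (sub_left_injective (b := a))]
  rfl

theorem cyclicLE_of_card_filter_le {a : Fin n} {B C : KSubset k n}
    (h : ∀ t : ℕ, (C.1.filter fun b => fwdPos a b < t).card ≤
      (B.1.filter fun b => fwdPos a b < t).card) : cyclicLE a B C := by
  refine orderEmbOfFin_le_of_card_filter_le _ _ fun t => ?_
  rw [card_filter_positions, card_filter_positions]
  exact h t

theorem cyclicLE_antisymm {a : Fin n} {B C : KSubset k n} (h : cyclicLE a B C)
    (h' : cyclicLE a C B) : B = C := by
  have : NeZero n := ⟨by rintro rfl; exact a.elim0⟩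
  have h1 : (positions a B).1 = (positions a C).1 := by
    apply Finset.coe_injective
    rw [← range_orderEmbOfFin _ (positions a B).2, ← range_orderEmbOfFin _ (positions a C).2]
    congr 1
    funext i
    exact le_antisymm (h i) (h' i)
  exact Subtype.ext (Finset.image_injective (sub_left_injective (b := a)) h1)

variable {A : Matrix (Fin k) (Fin n) ℂ}

theorem isMinimalBasis_iff (hA : A.rank = k) (a : Fin n) (I : KSubset k n) :
    IsMinimalBasis (columnMatroid A) a I ↔ I.1 = greedyBasis ℂ (fwdPos a) A.col := by
  have hG : IsMinimalBasis (columnMatroid A) a (greedySubset A hA _ (fwdPos_injective a)) := by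
    refine ⟨greedySubset_mem_columnMatroid _ _ _ _, fun J hJ => cyclicLE_of_card_filter_le ?_⟩
    rw [mem_columnMatroid_iff_linearIndepOn] at hJ
    exact card_filter_le_card_greedyBasis (fwdPos_injective a) hJ
  constructor
  · intro hI
    rw [cyclicLE_antisymm (hI.2 _ hG.1) (hG.2 _ hI.1)]
    rfl
  · intro hI
    rwa [show I = greedySubset A hA _ (fwdPos_injective a) from Subtype.ext hI]

/-- Descending from `a` is the reverse of ascending from `a + 1`; this turns the `(a + 1)`-maximal
basis into a greedy basis for `bwdPos a`. -/
theorem fwdPos_finRotate (a b : Fin n) : fwdPos (finRotate n a) b + bwdPos a b + 1 = n := by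
  have : NeZero n := ⟨by rintro rfl; exact a.elim0⟩
  obtain ⟨m, rfl⟩ : ∃ m, n = m + 1 := ⟨n - 1, by have := a.2; omega⟩
  simp only [fwdPos, bwdPos]
  have h1 : (finRotate (m + 1) a).val = if a.val = m then 0 else a.val + 1 := by
    rw [finRotate_apply, Fin.val_add_one]
    simp [Fin.ext_iff]
  have := val_sub_cases b (finRotate (m + 1) a)
  have := val_sub_cases a b
  split_ifs at h1 <;> omega

theorem isMaximalBasis_iff (hA : A.rank = k) (a : Fin n) (I : KSubset k n) :
    IsMaximalBasis (columnMatroid A) a I ↔ I.1 = greedyBasis ℂ (bwdPos a) A.col := by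
  have hG : IsMaximalBasis (columnMatroid A) a (greedySubset A hA _ (bwdPos_injective a)) := by
    refine ⟨greedySubset_mem_columnMatroid _ _ _ _, fun J hJ => cyclicLE_of_card_filter_le ?_⟩
    intro t
    rw [mem_columnMatroid_iff_linearIndepOn] at hJ
    have h1 := card_filter_le_card_greedyBasis (bwdPos_injective a) hJ (n - t)
    have key : ∀ X : KSubset k n, (X.1.filter fun b => fwdPos (finRotate n a) b < t).card +
        (X.1.filter fun b => bwdPos a b < n - t).card = k := by
      intro X
      refine Eq.trans ?_ ((card_filter_add_card_filter_not (s := X.1)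
        (fun b => fwdPos (finRotate n a) b < t)).trans X.2)
      congr 2
      ext b
      simp only [mem_filter]
      have := fwdPos_finRotate a b
      refine and_congr_right fun _ => ?_
      omega
    have h2 := key J
    have h3 := key (greedySubset A hA _ (bwdPos_injective a))
    have h4 : (greedySubset A hA _ (bwdPos_injective a)).1 = greedyBasis ℂ (bwdPos a) A.col := rfl
    rw [h4] at h3 ⊢
    omega
  constructor
  · intro hI
    rw [cyclicLE_antisymm (hG.2 _ hI.1) (hI.2 _ hG.1)]
    rfl
  · intro hI
    rwa [show I = greedySubset A hA _ (bwdPos_injective a) from Subtype.ext hI]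

end CyclicLE

/-- The position functions of the cyclic orders starting at the points of a cycle. -/
structure IsCyclicPosition {n : ℕ} (q : Fin n → Fin n → ℕ) : Prop where
  self : ∀ a, q a a = 0
  injective : ∀ a, Function.Injective (q a)
  shift : ∀ {b c e f}, q c b ≤ q c e → q b f < q b e → q c f < q c e
  flip : ∀ {a b e}, 0 < q b e → q b e ≤ q b a → q e a < q b a

theorem isCyclicPosition_fwdPos {n : ℕ} : IsCyclicPosition (fwdPos (n := n)) where
  self a := by
    have := val_sub_cases a a
    simp only [fwdPos]
    omega
  injective := fwdPos_injective
  shift {b c e f} := by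
    have := val_sub_cases b c
    have := val_sub_cases e c
    have := val_sub_cases f b
    have := val_sub_cases e b
    have := val_sub_cases f c
    simp only [fwdPos]
    omega
  flip {a b e} := by
    have := val_sub_cases e b
    have := val_sub_cases a b
    have := val_sub_cases a e
    simp only [fwdPos]
    omega

theorem isCyclicPosition_bwdPos {n : ℕ} : IsCyclicPosition (bwdPos (n := n)) where
  self a := by
    have := val_sub_cases a a
    simp only [bwdPos]
    omega
  injective := bwdPos_injective
  shift {b c e f} := by
    have := val_sub_cases c b
    have := val_sub_cases c e
    have := val_sub_cases b f
    have := val_sub_cases b e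
    have := val_sub_cases c f
    simp only [bwdPos]
    omega
  flip {a b e} := by
    have := val_sub_cases b e
    have := val_sub_cases b a
    have := val_sub_cases e a
    simp only [bwdPos]
    omega

/-! ### The twist for an abstract family of cyclic orders. -/

section Twist

variable {K : Type*} [Field K] {k n : ℕ}

/-- The columns of `T` are dual to those of `A` with respect to the greedy bases given by `q`. -/
def IsTwist (q : Fin n → Fin n → ℕ) (A T : Matrix (Fin k) (Fin n) K) : Prop :=
  ∀ a, ∀ b ∈ greedyBasis K (q a) A.col, T.col a ⬝ᵥ A.col b = if a = b then 1 else 0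

theorem dotProduct_eq_zero_of_mem_span {w : Fin k → K} {s : Set (Fin k → K)}
    (h : ∀ u ∈ s, w ⬝ᵥ u = 0) {u : Fin k → K} (hu : u ∈ Submodule.span K s) : w ⬝ᵥ u = 0 := by
  induction hu using Submodule.span_induction with
  | mem u hu => exact h u hu
  | zero => simp
  | add u v _ _ hu hv => rw [dotProduct_add, hu, hv, add_zero]
  | smul c u _ hu => rw [dotProduct_smul, hu, smul_zero]

variable {q : Fin n → Fin n → ℕ} {A T : Matrix (Fin k) (Fin n) K}

/-- Starting later, at `b`, leaves fewer columns before `e`, so it is easier for `e` to be greedy.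
-/
theorem IsCyclicPosition.mem_greedyBasis (hq : IsCyclicPosition q) {v : Fin n → Fin k → K}
    {b c e : Fin n} (he : e ∈ greedyBasis K (q c) v) (hbe : q c b ≤ q c e) :
    e ∈ greedyBasis K (q b) v := by
  rw [PositroidTwist.mem_greedyBasis] at he ⊢
  exact fun h => he (Submodule.span_mono (Set.image_mono fun f hf => hq.shift hbe hf) h)

theorem IsCyclicPosition.eq_of_eq_zero (hq : IsCyclicPosition q) {a b : Fin n} (h : q a b = 0) :
    a = b := hq.injective a ((hq.self a).trans h.symm)

/-- The greedy elements at `c` from position `q c b` on are also greedy at `b`, so one duality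
relation for `T.col b` covers them all. Triangularity does the rest: pairing with the twisted column
at position `m` reads off the coefficient of the greedy vector there, if any. -/
theorem IsTwist.annihilator (hq : IsCyclicPosition q) (hA : A.rank = k) (hT : IsTwist q A T)
    (c : Fin n) (m : ℕ) (w : Fin k → K) : (∀ b, q c b < m → T.col b ⬝ᵥ w = 0) ↔
      w ∈ Submodule.span K (A.col '' {e | e ∈ greedyBasis K (q c) A.col ∧ m ≤ q c e}) := by
  constructor
  · intro h
    induction m with
    | zero =>
      have : {e | e ∈ greedyBasis K (q c) A.col ∧ 0 ≤ q c e} =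
          (greedyBasis K (q c) A.col : Set (Fin n)) := by
        ext e
        simp
      rw [this, span_greedyBasis, (span_range_col_eq_top_iff A).2 hA]
      trivial
    | succ m ih =>
      have h1 := ih fun b hb => h b (by omega)
      by_cases hex : ∃ e ∈ greedyBasis K (q c) A.col, q c e = m
      · obtain ⟨e, he, rfl⟩ := hex
        have h2 : {f | f ∈ greedyBasis K (q c) A.col ∧ q c e ≤ q c f} =
            insert e {f | f ∈ greedyBasis K (q c) A.col ∧ q c e + 1 ≤ q c f} := by
          ext f
          simp only [Set.mem_ofPred_eq, Set.mem_insert_iff]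
          constructor
          · rintro ⟨hf, hef⟩
            rcases Nat.eq_or_lt_of_le hef with h' | h'
            · exact Or.inl (hq.injective c h'.symm)
            · exact Or.inr ⟨hf, h'⟩
          · rintro (rfl | ⟨hf, h'⟩)
            · exact ⟨he, le_rfl⟩
            · exact ⟨hf, by omega⟩
        rw [h2, Set.image_insert_eq, Submodule.mem_span_insert] at h1
        obtain ⟨x, z, hz, rfl⟩ := h1
        have h3 := h e (by omega)
        have h4 : T.col e ⬝ᵥ z = 0 := by
          refine dotProduct_eq_zero_of_mem_span ?_ hz
          rintro _ ⟨f, ⟨hf, hef⟩, rfl⟩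
          rw [hT e f (hq.mem_greedyBasis hf (by omega)), if_neg]
          rintro rfl
          omega
        rw [dotProduct_add, h4, dotProduct_smul, hT e e (hq.mem_greedyBasis he le_rfl),
          if_pos rfl, add_zero, smul_eq_mul, mul_one] at h3
        rw [h3, zero_smul, zero_add]
        exact hz
      · refine Submodule.span_mono (Set.image_mono ?_) h1
        rintro e ⟨he, hme⟩
        exact ⟨he, Nat.succ_le_iff.2 (lt_of_le_of_ne hme fun h' => hex ⟨e, he, h'.symm⟩)⟩
  · intro hw b hb
    refine dotProduct_eq_zero_of_mem_span ?_ hw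
    rintro _ ⟨e, ⟨he, hme⟩, rfl⟩
    rw [hT b e (hq.mem_greedyBasis he (by omega)), if_neg]
    rintro rfl
    omega

theorem finrank_span_add_finrank_ker (T : Matrix (Fin k) (Fin n) K) (s : Set (Fin n))
    (W : Submodule K (Fin k → K)) (hW : ∀ w, w ∈ W ↔ ∀ b ∈ s, T.col b ⬝ᵥ w = 0) :
    Module.finrank K (Submodule.span K (T.col '' s)) + Module.finrank K W = k := by
  set Y : Matrix s (Fin k) K := Matrix.of fun e i => T i e with hY
  have h1 := LinearMap.finrank_range_add_finrank_ker Y.mulVecLin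
  have h2 : Y.rank = Module.finrank K (Submodule.span K (T.col '' s)) := by
    rw [Matrix.rank_eq_finrank_span_row, Set.image_eq_range]
    rfl
  have h3 : LinearMap.ker Y.mulVecLin = W := by
    ext w
    rw [hW, LinearMap.mem_ker]
    constructor
    · intro h b hb
      exact congrFun h ⟨b, hb⟩
    · intro h
      funext b
      exact h b b.2
  rw [← h2, ← h3, Matrix.rank]
  simpa using h1

theorem IsTwist.finrank_span_eq (hq : IsCyclicPosition q) (hA : A.rank = k) (hT : IsTwist q A T)
    (c : Fin n) (m : ℕ) : Module.finrank K (Submodule.span K (T.col '' {e | q c e < m})) =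
      Module.finrank K (Submodule.span K (A.col '' {e | q c e < m})) := by
  have h1 := finrank_span_add_finrank_ker T {e | q c e < m} _
    fun w => (hT.annihilator hq hA c m w).symm
  rw [finrank_span_lt_eq_card (v := A.col) (hq.injective c)]
  have h2 : {e | e ∈ greedyBasis K (q c) A.col ∧ m ≤ q c e} =
      ((greedyBasis K (q c) A.col).filter fun e => ¬ q c e < m : Set (Fin n)) := by
    rw [coe_filter]
    simp
  rw [h2, finrank_span_image_of_linearIndepOn ((linearIndepOn_greedyBasis (hq.injective c)).mono
    (coe_subset.2 (filter_subset _ _)))] at h1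
  have h3 := card_filter_add_card_filter_not (s := greedyBasis K (q c) A.col) fun e => q c e < m
  rw [card_greedyBasis hA (hq.injective c)] at h3
  omega

theorem IsTwist.rank_eq (hq : IsCyclicPosition q) (hA : A.rank = k) (hT : IsTwist q A T) :
    T.rank = k := by
  rcases Nat.eq_zero_or_pos n with rfl | hn
  · rwa [show T = A from Matrix.ext fun _ a => a.elim0]
  · have h := hT.finrank_span_eq hq hA ⟨0, hn⟩ (univ.sup (q ⟨0, hn⟩) + 1)
    have h1 : {e | q ⟨0, hn⟩ e < univ.sup (q ⟨0, hn⟩) + 1} = Set.univ := by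
      ext e
      simpa using Nat.lt_succ_iff.2 (le_sup (f := q ⟨0, hn⟩) (mem_univ e))
    rw [h1, Set.image_univ, Set.image_univ, ← Matrix.rank_eq_finrank_span_cols,
      ← Matrix.rank_eq_finrank_span_cols] at h
    rw [h, hA]

/-- Twisting back in the opposite cyclic order recovers the matrix. -/
theorem IsTwist.symm (hq : IsCyclicPosition q) (hT : IsTwist q A T)
    (hG : ∀ a, greedyBasis K (fun b => q b a) T.col = greedyBasis K (fun b => q b a) A.col) :
    IsTwist (fun a b => q b a) T A := by
  intro a b hb
  rw [hG a, mem_greedyBasis] at hb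
  rw [dotProduct_comm]
  by_cases hab : a = b
  · subst hab
    rw [if_pos rfl, hT a a, if_pos rfl]
    rw [mem_greedyBasis]
    refine fun h => hb (Submodule.span_mono (Set.image_mono fun e he => ?_) h)
    simp [hq.self] at he
  rw [if_neg hab]
  have hba : 0 < q b a := Nat.pos_of_ne_zero fun h => hab (hq.eq_of_eq_zero h).symm
  -- Expand `A.col a` in the part of the greedy basis at `b` lying between `b` and `a`; pairing with
  -- `T.col b` extracts the coefficient of `A.col b`.
  have h1 := mem_span_greedyBasis_le (K := K) (q := q b) (v := A.col) a
  by_cases hbG : b ∈ greedyBasis K (q b) A.col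
  · have h2 : {e | e ∈ greedyBasis K (q b) A.col ∧ q b e ≤ q b a} =
        insert b {e | e ∈ greedyBasis K (q b) A.col ∧ 0 < q b e ∧ q b e ≤ q b a} := by
      ext e
      simp only [Set.mem_ofPred_eq, Set.mem_insert_iff]
      constructor
      · rintro ⟨he, hea⟩
        rcases Nat.eq_zero_or_pos (q b e) with h' | h'
        · exact Or.inl (hq.eq_of_eq_zero h').symm
        · exact Or.inr ⟨he, h', hea⟩
      · rintro (rfl | ⟨he, h', hea⟩)
        · exact ⟨hbG, by rw [hq.self]; exact Nat.zero_le _⟩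
        · exact ⟨he, hea⟩
    rw [h2, Set.image_insert_eq, Submodule.mem_span_insert] at h1
    obtain ⟨x, z, hz, hxz⟩ := h1
    have h3 : T.col b ⬝ᵥ z = 0 := by
      refine dotProduct_eq_zero_of_mem_span ?_ hz
      rintro _ ⟨e, ⟨he, h0, -⟩, rfl⟩
      rw [hT b e he, if_neg]
      rintro rfl
      rw [hq.self] at h0
      exact lt_irrefl _ h0
    -- A nonzero coefficient would express `A.col b` through columns strictly nearer to `a`,
    -- contradicting that `b` is greedy for the opposite order at `a`.
    have hx : x = 0 := by
      by_contra hx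
      apply hb
      have h4 : A.col b = x⁻¹ • (A.col a - z) := by
        rw [hxz, add_sub_cancel_right, smul_smul, inv_mul_cancel₀ hx, one_smul]
      rw [h4]
      refine Submodule.smul_mem _ _ (Submodule.sub_mem _ ?_ ?_)
      · exact Submodule.subset_span ⟨a, by simpa [hq.self] using hba, rfl⟩
      · refine Submodule.span_mono (Set.image_mono ?_) hz
        rintro e ⟨-, h0, hea⟩
        exact hq.flip h0 hea
    rw [hxz, hx, zero_smul, zero_add, h3]
  · refine dotProduct_eq_zero_of_mem_span ?_ h1
    rintro _ ⟨e, ⟨he, -⟩, rfl⟩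
    rw [hT b e he, if_neg]
    rintro rfl
    exact hbG he

theorem exists_dotProduct_eq {J : KSubset k n} (hJ : J ∈ columnMatroid A) (x : Fin n → K) :
    ∃ w : Fin k → K, ∀ b ∈ J.1, w ⬝ᵥ A.col b = x b := by
  rw [mem_columnMatroid_iff_minor] at hJ
  set N := A.submatrix id (J.1.orderEmbOfFin J.2) with hN
  have hdet : IsUnit N.det := isUnit_iff_ne_zero.2 hJ
  refine ⟨Matrix.vecMul (x ∘ J.1.orderEmbOfFin J.2) N⁻¹, fun b hb => ?_⟩
  obtain ⟨i, rfl⟩ : b ∈ Set.range (J.1.orderEmbOfFin J.2) := by simpa using hb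
  have h := congrFun (Matrix.vecMul_vecMul (x ∘ J.1.orderEmbOfFin J.2) N⁻¹ N) i
  rw [Matrix.nonsing_inv_mul N hdet, Matrix.vecMul_one] at h
  exact h

theorem IsTwist.unique (hA : A.rank = k)
    {T' : Matrix (Fin k) (Fin n) K} (hT : IsTwist q A T) (hT' : IsTwist q A T') : T = T' := by
  have key : ∀ a, T.col a = T'.col a := by
    intro a
    rw [← sub_eq_zero]
    refine dotProduct_eq_zero _ fun u => ?_
    have hu : u ∈ Submodule.span K (A.col '' (greedyBasis K (q a) A.col : Set (Fin n))) := by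
      rw [span_greedyBasis, (span_range_col_eq_top_iff A).2 hA]
      trivial
    refine dotProduct_eq_zero_of_mem_span ?_ hu
    rintro _ ⟨b, hb, rfl⟩
    rw [sub_dotProduct, hT a b hb, hT' a b hb, sub_self]
  ext i a
  exact congrFun (key a) i

theorem greedyBasis_mul {g : Matrix (Fin k) (Fin k) K} (hg : IsUnit g.det) (p : Fin n → ℕ) :
    greedyBasis K p (g * A).col = greedyBasis K p A.col := by
  have hcol : (g * A).col = fun b => g.mulVecLin (A.col b) := by
    funext b i
    simp [Matrix.mul_apply, Matrix.mulVec, dotProduct, Matrix.col]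
  have hinj : Function.Injective g.mulVecLin :=
    Matrix.mulVec_injective_iff_isUnit.2 ((Matrix.isUnit_iff_isUnit_det g).2 hg)
  ext b
  rw [mem_greedyBasis, mem_greedyBasis, hcol, not_iff_not]
  have h1 : (fun b => g.mulVecLin (A.col b)) '' {e | p e < p b} =
      g.mulVecLin '' (A.col '' {e | p e < p b}) := by rw [Set.image_image]
  rw [h1, Submodule.span_image]
  simp only
  rw [Submodule.mem_map]
  exact ⟨fun ⟨u, hu, h⟩ => hinj h ▸ hu, fun h => ⟨_, h, rfl⟩⟩

theorem IsTwist.mul {g : Matrix (Fin k) (Fin k) K} (hg : IsUnit g.det) (hT : IsTwist q A T) :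
    IsTwist q (g * A) (g⁻¹.transpose * T) := by
  intro a b hb
  rw [greedyBasis_mul hg] at hb
  rw [← hT a b hb]
  have h1 : (g⁻¹.transpose * T).col a = Matrix.vecMul (T.col a) g⁻¹ := by
    rw [← Matrix.mulVec_transpose]
    funext i
    simp [Matrix.mul_apply, Matrix.mulVec, dotProduct, Matrix.col]
  have h2 : (g * A).col b = g.mulVec (A.col b) := by
    funext i
    simp [Matrix.mul_apply, Matrix.mulVec, dotProduct, Matrix.col]
  rw [h1, h2, Matrix.dotProduct_mulVec, Matrix.vecMul_vecMul, Matrix.nonsing_inv_mul g hg,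
    Matrix.vecMul_one]

end Twist

/-! ### The right and left twists are mutually inverse on full-rank matrices. -/

section ComplexTwist

variable {k n : ℕ} {A : Matrix (Fin k) (Fin n) ℂ} {M : Set (KSubset k n)}

theorem isTwist_rightTwist (hA : A.rank = k) : IsTwist fwdPos A (rightTwist A) := by
  intro a
  set J := greedySubset A hA (fwdPos a) (fwdPos_injective a) with hJ
  have hmin : IsMinimalBasis (columnMatroid A) a J := (isMinimalBasis_iff hA a _).2 rfl
  have hspec := Classical.epsilon_spec (p := fun v : Fin k → ℂ => ∀ I,
    IsMinimalBasis (columnMatroid A) a I → ∀ b ∈ I.1, v ⬝ᵥ A.col b = if a = b then 1 else 0) (by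
      obtain ⟨w, hw⟩ := exists_dotProduct_eq hmin.1 (fun b => if a = b then 1 else 0)
      refine ⟨w, fun I hI => ?_⟩
      rw [(isMinimalBasis_iff hA a I).1 hI]
      exact hw)
  exact hspec J hmin

theorem isTwist_leftTwist (hA : A.rank = k) : IsTwist bwdPos A (leftTwist A) := by
  intro a
  set J := greedySubset A hA (bwdPos a) (bwdPos_injective a) with hJ
  have hmax : IsMaximalBasis (columnMatroid A) a J := (isMaximalBasis_iff hA a _).2 rfl
  have hspec := Classical.epsilon_spec (p := fun v : Fin k → ℂ => ∀ I,
    IsMaximalBasis (columnMatroid A) a I → ∀ b ∈ I.1, v ⬝ᵥ A.col b = if a = b then 1 else 0) (by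
      obtain ⟨w, hw⟩ := exists_dotProduct_eq hmax.1 (fun b => if a = b then 1 else 0)
      refine ⟨w, fun I hI => ?_⟩
      rw [(isMaximalBasis_iff hA a I).1 hI]
      exact hw)
  exact hspec J hmax

theorem intervalRank_rightTwist (hA : A.rank = k) (a : Fin n) (m : ℕ) :
    intervalRank (rightTwist A) a m = intervalRank A a m :=
  (isTwist_rightTwist hA).finrank_span_eq isCyclicPosition_fwdPos hA a m

theorem finrank_span_bwdPos_eq {B : Matrix (Fin k) (Fin n) ℂ}
    (h : ∀ a m, intervalRank B a m = intervalRank A a m) (c : Fin n) (m : ℕ) :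
    Module.finrank ℂ (Submodule.span ℂ (B.col '' {e | bwdPos c e < m})) =
      Module.finrank ℂ (Submodule.span ℂ (A.col '' {e | bwdPos c e < m})) := by
  obtain ⟨a, m', hc⟩ := exists_fwdPos_lt_iff c m
  have hs : {e | fwdPos a e < m'} = {e | bwdPos c e < m} := Set.ext hc
  rw [← hs]
  exact h a m'

theorem intervalRank_leftTwist (hA : A.rank = k) (a : Fin n) (m : ℕ) :
    intervalRank (leftTwist A) a m = intervalRank A a m := by
  obtain ⟨c, m', hc⟩ := exists_bwdPos_lt_iff a m
  have := (isTwist_leftTwist hA).finrank_span_eq isCyclicPosition_bwdPos hA c m'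
  have hs : {e | bwdPos c e < m'} = {e | fwdPos a e < m} := Set.ext hc
  rwa [hs] at this

theorem rightTwist_mem_matVariety (hA : A ∈ matVariety M) : rightTwist A ∈ matVariety M :=
  mem_matVariety_of_intervalRank_eq hA
    ((isTwist_rightTwist hA.1).rank_eq isCyclicPosition_fwdPos hA.1) (intervalRank_rightTwist hA.1)

theorem leftTwist_mem_matVariety (hA : A ∈ matVariety M) : leftTwist A ∈ matVariety M :=
  mem_matVariety_of_intervalRank_eq hA
    ((isTwist_leftTwist hA.1).rank_eq isCyclicPosition_bwdPos hA.1) (intervalRank_leftTwist hA.1)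

/-- `bwdPos a b` is `fwdPos b a` by definition, so `IsTwist.symm` exhibits `A` as a left twist of
its right twist, and twists are unique. -/
theorem leftTwist_rightTwist (hA : A.rank = k) : leftTwist (rightTwist A) = A := by
  have hR := isTwist_rightTwist hA
  have hr := hR.rank_eq isCyclicPosition_fwdPos hA
  refine (isTwist_leftTwist hr).unique hr ?_
  exact hR.symm isCyclicPosition_fwdPos fun a => greedyBasis_congr (bwdPos_injective a)
    (finrank_span_bwdPos_eq (intervalRank_rightTwist hA) a)

theorem rightTwist_leftTwist (hA : A.rank = k) : rightTwist (leftTwist A) = A := by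
  have hL := isTwist_leftTwist hA
  have hr := hL.rank_eq isCyclicPosition_bwdPos hA
  refine (isTwist_rightTwist hr).unique hr ?_
  exact hL.symm isCyclicPosition_bwdPos fun a => greedyBasis_congr (fwdPos_injective a)
    (intervalRank_leftTwist hA a)

end ComplexTwist

/-! ### Plücker coordinates of the twist as rational functions. -/

section Polynomials

variable {k n : ℕ}

theorem exists_colsPoly (f : Fin k → Fin n) : ∃ L : MvPolynomial (KSubset k n) ℂ,
    L.IsHomogeneous 1 ∧ ∀ A, MvPolynomial.eval (pluckerVector A) L = detCols A f := by
  by_cases hf : Function.Injective f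
  · obtain ⟨σ, hσ⟩ := exists_detCols_eq_sign_mul_minor (K := ℂ) hf
    refine ⟨MvPolynomial.C ((Equiv.Perm.sign σ : ℤ) : ℂ) * MvPolynomial.X (imageSubset f hf),
      MvPolynomial.isHomogeneous_C_mul_X _ _, fun A => ?_⟩
    rw [hσ]
    simp [pluckerVector]
  · refine ⟨0, MvPolynomial.isHomogeneous_zero _ _ _, fun A => ?_⟩
    rw [detCols_eq_zero_of_not_injective A hf, map_zero]

/-- The determinant `det (A_{f 1}, …, A_{f k})` as a polynomial in the Plücker coordinates. -/
def colsPoly (f : Fin k → Fin n) : MvPolynomial (KSubset k n) ℂ := (exists_colsPoly f).choose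

theorem isHomogeneous_colsPoly (f : Fin k → Fin n) : (colsPoly f).IsHomogeneous 1 :=
  (exists_colsPoly f).choose_spec.1

theorem eval_colsPoly (f : Fin k → Fin n) (A : Matrix (Fin k) (Fin n) ℂ) :
    MvPolynomial.eval (pluckerVector A) (colsPoly f) = detCols A f :=
  (exists_colsPoly f).choose_spec.2 A

theorem detCols_eq_of_pluckerVector_eq {A A' : Matrix (Fin k) (Fin n) ℂ}
    (h : pluckerVector A = pluckerVector A') (f : Fin k → Fin n) : detCols A f = detCols A' f := by
  rw [← eval_colsPoly, ← eval_colsPoly, h]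

theorem detCols_smul_col {K : Type*} [Field K] (A : Matrix (Fin k) (Fin n) K) (f : Fin k → Fin n)
    (j : Fin n) : detCols A f • A.col j =
      ∑ i, detCols A (Function.update f i j) • A.col (f i) := by
  have h := Matrix.mulVec_cramer (A.submatrix id f) (A.col j)
  rw [detCols, ← h]
  funext r
  rw [Matrix.mulVec, dotProduct, Finset.sum_apply]
  refine sum_congr rfl fun i _ => ?_
  rw [Matrix.cramer_apply, Pi.smul_apply, smul_eq_mul, mul_comm]
  congr 1
  rw [detCols]
  congr 1
  ext s t
  by_cases ht : t = i
  · subst ht; simp [Matrix.col]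
  · simp [Matrix.updateCol_ne ht, Function.update_of_ne ht]

/-- Cramer's rule expands `A.col j` in the columns listed by `f`, and `w` keeps only the coefficient
at `a`; if `a` is not listed, both sides are zero. -/
theorem detCols_mul_dotProduct {K : Type*} [Field K] {A : Matrix (Fin k) (Fin n) K}
    {f : Fin k → Fin n} {w : Fin k → K} {a : Fin n}
    (hw : ∀ i, w ⬝ᵥ A.col (f i) = if a = f i then 1 else 0) (j : Fin n) :
    detCols A f * (w ⬝ᵥ A.col j) =
      ∑ i, if a = f i then detCols A (Function.update f i j) else 0 := by
  have h := congrArg (fun u => w ⬝ᵥ u) (detCols_smul_col A f j)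
  simp only [dotProduct_smul, dotProduct_sum, smul_eq_mul, hw] at h
  rw [h]
  refine sum_congr rfl fun i _ => ?_
  split_ifs <;> simp

/-- The numerator of the pairing of a column of the twist with a column of the matrix. -/
def pairingPoly (f : Fin k → Fin n) (a j : Fin n) : MvPolynomial (KSubset k n) ℂ :=
  ∑ i, if a = f i then colsPoly (Function.update f i j) else 0

theorem isHomogeneous_pairingPoly (f : Fin k → Fin n) (a j : Fin n) :
    (pairingPoly f a j).IsHomogeneous 1 := by
  refine MvPolynomial.IsHomogeneous.sum _ _ _ fun i _ => ?_
  split_ifs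
  · exact isHomogeneous_colsPoly _
  · exact MvPolynomial.isHomogeneous_zero _ _ _

/-- The numerators of the Plücker coordinates of the twist, where `E a` lists the basis defining
the `a`th column of the twist and `g` lists an auxiliary basis. -/
def twistNumerator (E : Fin n → Fin k → Fin n) (g : Fin k → Fin n) (I : KSubset k n) :
    MvPolynomial (KSubset k n) ℂ :=
  (Matrix.of fun s t : Fin k => pairingPoly (E (I.1.orderEmbOfFin I.2 s))
    (I.1.orderEmbOfFin I.2 s) (g t)).det * ∏ a ∈ I.1ᶜ, colsPoly (E a)

/-- The common denominator of the Plücker coordinates of the twist. -/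
def twistDenominator (E : Fin n → Fin k → Fin n) (g : Fin k → Fin n) :
    MvPolynomial (KSubset k n) ℂ :=
  colsPoly g * ∏ a, colsPoly (E a)

theorem isHomogeneous_twistNumerator (E : Fin n → Fin k → Fin n) (g : Fin k → Fin n)
    (I : KSubset k n) : (twistNumerator E g I).IsHomogeneous n := by
  have h1 : (Matrix.of fun s t : Fin k => pairingPoly (E (I.1.orderEmbOfFin I.2 s))
      (I.1.orderEmbOfFin I.2 s) (g t)).det.IsHomogeneous (∑ _s : Fin k, 1) := by
    rw [Matrix.det_apply']
    refine MvPolynomial.IsHomogeneous.sum _ _ _ fun σ _ => ?_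
    have h2 := MvPolynomial.IsHomogeneous.prod (univ : Finset (Fin k)) (fun i =>
      (Matrix.of fun s t : Fin k => pairingPoly (E (I.1.orderEmbOfFin I.2 s))
        (I.1.orderEmbOfFin I.2 s) (g t)) (σ i) i) (fun _ => 1)
      (fun i _ => isHomogeneous_pairingPoly _ _ _)
    have h3 := (MvPolynomial.isHomogeneous_C (KSubset k n)
      (((Equiv.Perm.sign σ : ℤˣ) : ℤ) : ℂ)).mul h2
    rw [zero_add] at h3
    simpa using h3
  have h2 := MvPolynomial.IsHomogeneous.prod (I.1ᶜ) (fun a => colsPoly (E a)) (fun _ => 1)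
    (fun i _ => isHomogeneous_colsPoly _)
  have h3 := h1.mul h2
  -- The determinant has degree `k` and the complementary product degree `n - k`. That product
  -- clears denominators uniformly, which gives the same degree for every `I`.
  have h4 : (∑ _s : Fin k, 1) + ∑ _a ∈ I.1ᶜ, 1 = n := by
    have := card_add_card_compl I.1
    rw [I.2] at this
    simpa using this
  rwa [h4] at h3

theorem isHomogeneous_twistDenominator (E : Fin n → Fin k → Fin n) (g : Fin k → Fin n) :
    (twistDenominator E g).IsHomogeneous (1 + ∑ _a : Fin n, 1) :=
  (isHomogeneous_colsPoly g).mul (MvPolynomial.IsHomogeneous.prod univ (fun a => colsPoly (E a))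
    (fun _ => 1) (fun _ _ => isHomogeneous_colsPoly _))

theorem eval_twistDenominator (E : Fin n → Fin k → Fin n) (g : Fin k → Fin n)
    (A : Matrix (Fin k) (Fin n) ℂ) :
    MvPolynomial.eval (pluckerVector A) (twistDenominator E g) =
      detCols A g * ∏ a, detCols A (E a) := by
  rw [twistDenominator, map_mul, map_prod, eval_colsPoly]
  simp only [eval_colsPoly]

/-- The product of the minors of `T` at `I` and of `A` at `g` is the determinant of the pairings of
their columns; row `s` is scaled by the minor of `A` at the basis for the corresponding element of
`I`. -/
theorem eval_twistNumerator {E : Fin n → Fin k → Fin n} (g : Fin k → Fin n)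
    {A T : Matrix (Fin k) (Fin n) ℂ}
    (hT : ∀ a i, T.col a ⬝ᵥ A.col (E a i) = if a = E a i then 1 else 0) (I : KSubset k n) :
    MvPolynomial.eval (pluckerVector A) (twistNumerator E g I) =
      MvPolynomial.eval (pluckerVector A) (twistDenominator E g) * minor T I := by
  set u := I.1.orderEmbOfFin I.2 with hu
  have hpair : ∀ a j, MvPolynomial.eval (pluckerVector A) (pairingPoly (E a) a j) =
      detCols A (E a) * (T.col a ⬝ᵥ A.col j) := by
    intro a j
    rw [detCols_mul_dotProduct (hT a), pairingPoly, map_sum]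
    refine sum_congr rfl fun i _ => ?_
    split_ifs
    · rw [eval_colsPoly]
    · simp
  have hdet : MvPolynomial.eval (pluckerVector A)
      (Matrix.of fun s t : Fin k => pairingPoly (E (u s)) (u s) (g t)).det =
      (∏ s, detCols A (E (u s))) * (minor T I * detCols A g) := by
    have h1 : minor T I * detCols A g =
        (Matrix.of fun s t : Fin k => T.col (u s) ⬝ᵥ A.col (g t)).det := by
      rw [minor, detCols, ← Matrix.det_transpose (T.submatrix _ _), ← Matrix.det_mul]
      congr 1
    rw [h1, ← Matrix.det_mul_column, RingHom.map_det]
    congr 1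
    ext s t
    simp only [RingHom.mapMatrix_apply, Matrix.map_apply, Matrix.of_apply, hpair]
  have hprod : ∏ s, detCols A (E (u s)) = ∏ a ∈ I.1, detCols A (E a) := by
    have h1 : I.1 = univ.image u := by
      apply Finset.coe_injective
      simp [hu]
    rw [h1, prod_image (fun _ _ _ _ h => u.injective h)]
  rw [eval_twistDenominator, twistNumerator, map_mul, hdet, hprod, map_prod,
    ← prod_mul_prod_compl I.1 fun a => detCols A (E a)]
  simp only [eval_colsPoly]
  ring

end Polynomials

/-! ### Matrices with the same Plücker coordinates or the same row span -/

section Classes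

variable {k n : ℕ} {A A' : Matrix (Fin k) (Fin n) ℂ}

theorem detCols_mul (g : Matrix (Fin k) (Fin k) ℂ) (A : Matrix (Fin k) (Fin n) ℂ)
    (f : Fin k → Fin n) : detCols (g * A) f = g.det * detCols A f := by
  rw [detCols, detCols, ← Matrix.det_mul]
  rfl

theorem pluckerVector_mul (g : Matrix (Fin k) (Fin k) ℂ) (A : Matrix (Fin k) (Fin n) ℂ) :
    pluckerVector (g * A) = fun I => g.det * pluckerVector A I :=
  funext fun _ => detCols_mul g A _

theorem exists_detCols_ne_zero (hA : A.rank = k) : ∃ f : Fin k → Fin n, detCols A f ≠ 0 := by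
  obtain ⟨J, hJ⟩ := columnMatroid_nonempty hA
  exact ⟨_, (mem_columnMatroid_iff_minor A J).1 hJ⟩

/-- Relative to a fixed basis of columns, Cramer's rule gives all other columns the same coordinates
in both matrices. The change of basis on these `k` columns therefore carries every column along. -/
theorem exists_mul_of_pluckerVector_eq (hA : A.rank = k)
    (h : pluckerVector A = pluckerVector A') :
    ∃ g : Matrix (Fin k) (Fin k) ℂ, g.det = 1 ∧ A' = g * A := by
  obtain ⟨f, hf⟩ := exists_detCols_ne_zero hA
  have hdet := detCols_eq_of_pluckerVector_eq h
  set N := A.submatrix id f with hN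
  set N' := A'.submatrix id f with hN'
  have hu : IsUnit N.det := isUnit_iff_ne_zero.2 hf
  have hgN : N' * N⁻¹ * N = N' := by
    rw [Matrix.mul_assoc, Matrix.nonsing_inv_mul N hu, Matrix.mul_one]
  refine ⟨N' * N⁻¹, ?_, ?_⟩
  · have h1 := congrArg Matrix.det hgN
    rw [Matrix.det_mul] at h1
    have h2 : N'.det = N.det := (hdet f).symm
    rw [h2] at h1
    exact mul_right_cancel₀ hu.ne_zero (h1.trans (one_mul _).symm)
  · have hcol : ∀ i, (N' * N⁻¹).mulVec (A.col (f i)) = A'.col (f i) := by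
      intro i
      funext r
      exact congrFun (congrFun hgN r) i
    have key : ∀ j, A'.col j = (N' * N⁻¹).mulVec (A.col j) := by
      intro j
      have h1 := congrArg (fun u => (N' * N⁻¹).mulVecLin u) (detCols_smul_col A f j)
      simp only [map_smul, map_sum, Matrix.mulVecLin_apply, hcol] at h1
      have h2 := detCols_smul_col A' f j
      simp only [← hdet] at h2
      rw [← h2] at h1
      exact (smul_right_injective _ hf h1).symm
    ext r j
    exact congrFun (key j) r

theorem rank_eq_of_rowSpan (V : Gr k n) (h : rowSpan A = V.1) : A.rank = k := by
  rw [Matrix.rank_eq_finrank_span_row]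
  exact (congrArg (fun W : Submodule ℂ (Fin n → ℂ) => Module.finrank ℂ W) h).trans V.2

theorem finrank_rowSpan (hA : A.rank = k) : Module.finrank ℂ (rowSpan A) = k := by
  rw [Matrix.rank_eq_finrank_span_row] at hA
  exact hA

theorem exists_mul_of_rowSpan_eq (hA' : A'.rank = k) (h : rowSpan A = rowSpan A') :
    ∃ g : Matrix (Fin k) (Fin k) ℂ, IsUnit g.det ∧ A' = g * A := by
  have h1 : ∀ i, ∃ c : Fin k → ℂ, ∑ j, c j • A.row j = A'.row i := by
    intro i
    rw [← Submodule.mem_span_range_iff_exists_fun]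
    change _ ∈ rowSpan A
    rw [h]
    exact Submodule.subset_span ⟨i, rfl⟩
  choose c hc using h1
  have h2 : A' = Matrix.of c * A := by
    ext i j
    have := congrFun (hc i) j
    simp only [Finset.sum_apply, Pi.smul_apply, smul_eq_mul, Matrix.row] at this
    rw [Matrix.mul_apply]
    exact this.symm
  refine ⟨Matrix.of c, ?_, h2⟩
  obtain ⟨f, hf⟩ := exists_detCols_ne_zero hA'
  rw [h2, detCols_mul] at hf
  exact isUnit_iff_ne_zero.2 (left_ne_zero_of_mul hf)

theorem rowSpan_mul_le (g : Matrix (Fin k) (Fin k) ℂ) (A : Matrix (Fin k) (Fin n) ℂ) :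
    rowSpan (g * A) ≤ rowSpan A := by
  refine Submodule.span_le.2 ?_
  rintro _ ⟨i, rfl⟩
  have : (g * A).row i = ∑ j, g i j • A.row j := by
    funext r
    simp [Matrix.row, Matrix.mul_apply]
  rw [this]
  exact Submodule.sum_mem _ fun j _ => Submodule.smul_mem _ _ (Submodule.subset_span ⟨j, rfl⟩)

theorem rowSpan_mul {g : Matrix (Fin k) (Fin k) ℂ} (hg : IsUnit g.det)
    (A : Matrix (Fin k) (Fin n) ℂ) : rowSpan (g * A) = rowSpan A := by
  refine le_antisymm (rowSpan_mul_le g A) ?_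
  have := rowSpan_mul_le g⁻¹ (g * A)
  rwa [← Matrix.mul_assoc, Matrix.nonsing_inv_mul g hg, Matrix.one_mul] at this

theorem mul_mem_matVariety {M : Set (KSubset k n)} {g : Matrix (Fin k) (Fin k) ℂ}
    (hg : IsUnit g.det) (hA : A ∈ matVariety M) : g * A ∈ matVariety M := by
  refine mem_matVariety_of_intervalRank_eq hA ?_ fun a m => ?_
  · rw [Matrix.rank_mul_eq_right_of_isUnit_det g A hg]
    exact hA.1
  · rw [intervalRank, intervalRank, finrank_span_lt_eq_card (fwdPos_injective a),
      finrank_span_lt_eq_card (fwdPos_injective a), greedyBasis_mul hg]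

theorem det_transpose_inv_isUnit {g : Matrix (Fin k) (Fin k) ℂ} (hg : IsUnit g.det) :
    IsUnit (g⁻¹.transpose).det := by
  rw [Matrix.det_transpose]
  exact Matrix.isUnit_nonsing_inv_det g hg

end Classes

/-! ### Descent to the positroid varieties and regularity -/

section Descent

variable {k n : ℕ} {M : Set (KSubset k n)}

/-- A map on `Mat°(M)` given by the duality with the greedy bases of a family of orders. -/
structure IsTwistMap (M : Set (KSubset k n)) (q : Fin n → Fin n → ℕ)
    (Φ : Matrix (Fin k) (Fin n) ℂ → Matrix (Fin k) (Fin n) ℂ) : Prop where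
  injective : ∀ a, Function.Injective (q a)
  isTwist : ∀ {A}, A.rank = k → IsTwist q A (Φ A)
  mem : ∀ {A}, A ∈ matVariety M → Φ A ∈ matVariety M
  greedyBasis_eq : ∀ {A A'}, A ∈ matVariety M → A' ∈ matVariety M → ∀ a,
    greedyBasis ℂ (q a) A.col = greedyBasis ℂ (q a) A'.col

theorem isTwistMap_rightTwist : IsTwistMap M fwdPos rightTwist where
  injective := fwdPos_injective
  isTwist := isTwist_rightTwist
  mem := rightTwist_mem_matVariety
  greedyBasis_eq hA hA' a := greedyBasis_congr (fwdPos_injective a)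
    (intervalRank_eq_of_mem_matVariety hA hA' a)

theorem isTwistMap_leftTwist : IsTwistMap M bwdPos leftTwist where
  injective := bwdPos_injective
  isTwist := isTwist_leftTwist
  mem := leftTwist_mem_matVariety
  greedyBasis_eq hA hA' a := greedyBasis_congr (bwdPos_injective a)
    (finrank_span_bwdPos_eq (intervalRank_eq_of_mem_matVariety hA hA') a)

namespace IsTwistMap

variable {q : Fin n → Fin n → ℕ} {Φ : Matrix (Fin k) (Fin n) ℂ → Matrix (Fin k) (Fin n) ℂ}

theorem map_mul (h : IsTwistMap M q Φ) {A : Matrix (Fin k) (Fin n) ℂ} (hA : A.rank = k)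
    {g : Matrix (Fin k) (Fin k) ℂ} (hg : IsUnit g.det) : Φ (g * A) = g⁻¹.transpose * Φ A := by
  have hgA : (g * A).rank = k := by rw [Matrix.rank_mul_eq_right_of_isUnit_det g A hg, hA]
  exact (h.isTwist hgA).unique hgA ((h.isTwist hA).mul hg)

theorem pluckerVector_eq (h : IsTwistMap M q Φ) {A A' : Matrix (Fin k) (Fin n) ℂ}
    (hA : A.rank = k) (hp : pluckerVector A = pluckerVector A') :
    pluckerVector (Φ A) = pluckerVector (Φ A') := by
  obtain ⟨g, hg, rfl⟩ := exists_mul_of_pluckerVector_eq hA hp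
  have hg' : IsUnit g.det := by rw [hg]; exact isUnit_one
  rw [h.map_mul hA hg', pluckerVector_mul, Matrix.det_transpose, Matrix.det_nonsing_inv, hg]
  simp

theorem rowSpan_eq (h : IsTwistMap M q Φ) {A A' : Matrix (Fin k) (Fin n) ℂ}
    (hA : A.rank = k) (hA' : A'.rank = k) (hp : rowSpan A = rowSpan A') :
    rowSpan (Φ A) = rowSpan (Φ A') := by
  obtain ⟨g, hg, rfl⟩ := exists_mul_of_rowSpan_eq hA' hp
  rw [h.map_mul hA hg, rowSpan_mul (det_transpose_inv_isUnit hg)]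

/-- The map induced on the positroid variety in the affine cone. -/
def coneMap (h : IsTwistMap M q Φ) (x : conePositroidVariety M) : conePositroidVariety M :=
  ⟨pluckerVector (Φ x.2.choose), _, h.mem x.2.choose_spec.1, rfl⟩

theorem coneMap_val (h : IsTwistMap M q Φ) {x : conePositroidVariety M}
    {A : Matrix (Fin k) (Fin n) ℂ} (hx : x.1 = pluckerVector A) :
    (h.coneMap x).1 = pluckerVector (Φ A) :=
  h.pluckerVector_eq x.2.choose_spec.1.1 (x.2.choose_spec.2.trans hx)

/-- The map induced on the positroid variety in the Grassmannian. -/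
def grMap (h : IsTwistMap M q Φ) (V : positroidVariety M) : positroidVariety M :=
  ⟨⟨rowSpan (Φ V.2.choose), finrank_rowSpan (h.mem V.2.choose_spec.1).1⟩,
    _, h.mem V.2.choose_spec.1, rfl⟩

theorem grMap_val (h : IsTwistMap M q Φ) {V : positroidVariety M}
    {A : Matrix (Fin k) (Fin n) ℂ} (hV : V.1.1 = rowSpan A) :
    (h.grMap V).1.1 = rowSpan (Φ A) :=
  h.rowSpan_eq V.2.choose_spec.1.1 (rank_eq_of_rowSpan V.1 hV.symm)
    (V.2.choose_spec.2.trans hV)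

theorem mem_matVariety_of_rowSpan {V : positroidVariety M}
    {A : Matrix (Fin k) (Fin n) ℂ} (hV : rowSpan A = V.1.1) : A ∈ matVariety M := by
  obtain ⟨A₀, hA₀, h₀⟩ := V.2
  obtain ⟨g, hg, rfl⟩ := exists_mul_of_rowSpan_eq (rank_eq_of_rowSpan V.1 hV) (h₀.trans hV.symm)
  exact mul_mem_matVariety hg hA₀

/-- The Plücker coordinates of the twist are, near `A₀`, quotients of polynomials. -/
theorem exists_twist_formula (h : IsTwistMap M q Φ) {A₀ : Matrix (Fin k) (Fin n) ℂ}
    (hA₀ : A₀ ∈ matVariety M) : ∃ (E : Fin n → Fin k → Fin n) (g : Fin k → Fin n),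
      MvPolynomial.eval (pluckerVector A₀) (twistDenominator E g) ≠ 0 ∧
      ∀ A ∈ matVariety M, ∀ I, MvPolynomial.eval (pluckerVector A) (twistNumerator E g I) =
        MvPolynomial.eval (pluckerVector A) (twistDenominator E g) * pluckerVector (Φ A) I := by
  obtain ⟨g, hg⟩ := exists_detCols_ne_zero hA₀.1
  set G := fun a => greedySubset A₀ hA₀.1 (q a) (h.injective a) with hG
  refine ⟨fun a => (G a).1.orderEmbOfFin (G a).2, g, ?_, fun A hA I => ?_⟩
  · rw [eval_twistDenominator]
    refine mul_ne_zero hg (prod_ne_zero_iff.2 fun a _ => ?_)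
    exact (mem_columnMatroid_iff_minor A₀ (G a)).1 (greedySubset_mem_columnMatroid _ _ _ _)
  · refine eval_twistNumerator g (fun a i => h.isTwist hA.1 a _ ?_) I
    -- The bases were chosen from `A₀` but serve every `A` in the variety; only the auxiliary `g` is
    -- adapted to `A₀`.
    rw [h.greedyBasis_eq hA hA₀]
    exact orderEmbOfFin_mem (G a).1 (G a).2 i

theorem isRegularAffineMap_coneMap (h : IsTwistMap M q Φ) : IsRegularAffineMap h.coneMap := by
  rintro I ⟨_, A₀, hA₀, rfl⟩
  obtain ⟨E, g, hne, hE⟩ := h.exists_twist_formula hA₀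
  refine ⟨twistNumerator E g I, twistDenominator E g, hne, ?_⟩
  rintro ⟨_, A, hA, rfl⟩ hy
  refine (congrFun (h.coneMap_val (A := A) rfl) I).trans ((eq_div_iff hy).2 ?_)
  exact (mul_comm _ _).trans (hE A hA I).symm

theorem isRegularGrMap_grMap (h : IsTwistMap M q Φ) : IsRegularGrMap h.grMap := by
  intro V₀
  obtain ⟨A₀, hA₀, hV₀⟩ := V₀.2
  obtain ⟨E, g, hne, hE⟩ := h.exists_twist_formula hA₀
  refine ⟨n, _, twistNumerator E g, twistDenominator E g, isHomogeneous_twistNumerator E g,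
    isHomogeneous_twistDenominator E g, ?_, ?_⟩
  · rintro _ ⟨A, hA, rfl⟩
    obtain ⟨u, hu, rfl⟩ := exists_mul_of_rowSpan_eq (rank_eq_of_rowSpan V₀.1 hA)
      (hV₀.trans hA.symm)
    rw [eval_twistDenominator] at hne ⊢
    simp only [detCols_mul]
    rw [prod_mul_distrib]
    exact mul_ne_zero (mul_ne_zero hu.ne_zero (left_ne_zero_of_mul hne))
      (mul_ne_zero (prod_ne_zero_iff.2 fun _ _ => hu.ne_zero) (right_ne_zero_of_mul hne))
  · rintro V _ _ ⟨A, hA, rfl⟩ ⟨A', hA', rfl⟩ hne'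
    have hAM := mem_matVariety_of_rowSpan hA
    have h1 : rowSpan (Φ A) = rowSpan A' := by rw [hA', h.grMap_val hA.symm]
    obtain ⟨u, hu, rfl⟩ := exists_mul_of_rowSpan_eq (rank_eq_of_rowSpan _ hA') h1
    -- The denominator is common to all coordinates and disappears projectively; `u` accounts for
    -- the choice of the matrix representing the image.
    refine ⟨u.det / MvPolynomial.eval (pluckerVector A) (twistDenominator E g),
      div_ne_zero hu.ne_zero hne', fun I => ?_⟩
    rw [pluckerVector_mul, hE A hAM I]
    field_simp

end IsTwistMap

end Descent

end PositroidTwist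

end

open PositroidTwist in
theorem mainTheorem4 (k n : ℕ) (M : Set (PositroidTwist.KSubset k n))
    (hM : PositroidTwist.IsPositroid M) :
    (∃ e : PositroidTwist.conePositroidVariety M ≃ PositroidTwist.conePositroidVariety M,
      PositroidTwist.IsRegularAffineMap e ∧ PositroidTwist.IsRegularAffineMap e.symm ∧
      ∀ (A : Matrix (Fin k) (Fin n) ℂ) (x : PositroidTwist.conePositroidVariety M),
        A ∈ PositroidTwist.matVariety M → x.1 = PositroidTwist.pluckerVector A →
          (e x).1 = PositroidTwist.pluckerVector (PositroidTwist.rightTwist A) ∧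
          (e.symm x).1 = PositroidTwist.pluckerVector (PositroidTwist.leftTwist A)) ∧
    (∃ e : PositroidTwist.positroidVariety M ≃ PositroidTwist.positroidVariety M,
      PositroidTwist.IsRegularGrMap e ∧ PositroidTwist.IsRegularGrMap e.symm ∧
      ∀ (A : Matrix (Fin k) (Fin n) ℂ) (V : PositroidTwist.positroidVariety M),
        A ∈ PositroidTwist.matVariety M → V.1.1 = PositroidTwist.rowSpan A →
          (e V).1.1 = PositroidTwist.rowSpan (PositroidTwist.rightTwist A) ∧
          (e.symm V).1.1 = PositroidTwist.rowSpan (PositroidTwist.leftTwist A)) := by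
  have hR : IsTwistMap M fwdPos rightTwist := isTwistMap_rightTwist
  have hL : IsTwistMap M bwdPos leftTwist := isTwistMap_leftTwist
  refine ⟨⟨⟨hR.coneMap, hL.coneMap, ?_, ?_⟩, hR.isRegularAffineMap_coneMap,
      hL.isRegularAffineMap_coneMap, fun A x _ hx => ⟨hR.coneMap_val hx, hL.coneMap_val hx⟩⟩,
    ⟨⟨hR.grMap, hL.grMap, ?_, ?_⟩, hR.isRegularGrMap_grMap,
      hL.isRegularGrMap_grMap, fun A V _ hV => ⟨hR.grMap_val hV, hL.grMap_val hV⟩⟩⟩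
  · rintro ⟨_, A, hA, rfl⟩
    apply Subtype.ext
    rw [hL.coneMap_val (hR.coneMap_val (A := A) rfl), leftTwist_rightTwist hA.1]
  · rintro ⟨_, A, hA, rfl⟩
    apply Subtype.ext
    rw [hR.coneMap_val (hL.coneMap_val (A := A) rfl), rightTwist_leftTwist hA.1]
  · intro V
    obtain ⟨A, hA, hV⟩ := V.2
    apply Subtype.ext
    apply Subtype.ext
    rw [hL.grMap_val (hR.grMap_val hV.symm), leftTwist_rightTwist hA.1, hV]
  · intro V
    obtain ⟨A, hA, hV⟩ := V.2
    apply Subtype.ext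
    apply Subtype.ext
    rw [hR.grMap_val (hL.grMap_val hV.symm), rightTwist_leftTwist hA.1, hV]
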